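/- Let $N\in\mathbb N$, let $\Omega\subset\mathbb R^N$ be an open set (in particular, $\Omega$ may be an unbounded domain with smooth bounded boundary), and let $T>0$. Put $H=L^2(\Omega)$ and $V=H^1(\Omega)$ with $(v,w)_V=\int_\Omega vw+\int_\Omega\nabla v\cdot\nabla w$; let $V^*$ be the dual of $V$ with the dual norm, and embed $H\subset V^*$ by $\langle h,z\rangle_{V^*,V}=(h,z)_H$. Assume: (C1) $\beta:\mathbb R\to\mathbb R$ is a single-valued maximal monotone function, and $\beta=\hat\beta'=\partial\hat\beta$ for a differentiable convex function $\hat\beta:\mathbb R\to[0,\infty)$ with $\hat\beta(0)=0$. There is a constant $c_1>0$ with $\hat\beta(r)\ge c_1|r|^2$ for all $r\in\mathbb R$. For every $z\in L^2(\Omega)$ with $\hat\beta(z)\in L^1(\Omega)$, one has $\beta(z)\in L^1_{\mathrm{loc}}(\Omega)$, and $\hat\beta(z+\psi)\in L^1(\Omega)$ for all $\psi\in C_c^\infty(\Omega)$. (C2) $g\in L^2(0,T;L^2(\Omega))$, and $f\in L^2(0,T;V)$ is the solution of the Neumann problem $(-\Delta+1)f(t)=g(t)$ in $\Omega$, $\partial_\nu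 f(t)=0$ on $\partial\Omega$, that is, for a.a. $t\in(0,T)$, $$\int_\Omega\nabla f(t)\cdot\nabla z+\int_\Omega f(t)z=\int_\Omega g(t)z\qquad\text{for all } z\in H^1(\Omega).$$ (C3) $u_0\in L^2(\Omega)$ and $\hat\beta(u_0)\in L^1(\Omega)$. A weak solution of $$u_t+(-\Delta+1)\beta(u)=g \text{ in }\Omega\times(0,T),\qquad \partial_\nu\beta(u)=0\text{ on }\partial\Omega\times(0,T),\qquad u(0)=u_0\text{ in }\Omega$$ is a pair $(u,\mu)$ with $u\in H^1(0,T;V^*)\cap L^\infty(0,T;H)$ and $\mu\in L^2(0,T;V)$ such that $\langle u'(t),z\rangle_{V^*,V}+(\mu(t),z)_V=0$ for all $z\in V$ and a.a. $t\in(0,T)$, $\mu(t)=\beta(u(t))-f(t)$ in $V$ for a.a. $t\in(0,T)$, and $u(0)=u_0$ (where $u$ is identified with its representative in $C([0,T];V^*)$). **Theorem.** Under these assumptions there exists a unique weak solution $(u,\mu)$. Moreover, the representative of $u$ in $C([0,T];V^*)$ satisfies $u(t)\in H$ for all $t\in[0,T]$, one has $\beta(u)\in L^2(0,T;V)$, and,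 with $M_1:=2\int_\Omega\hat\beta(u_0)+|f|_{L^2(0,T;V)}^2$, for all $t\in[0,T]$, $$\int_0^t|u'(s)|_{V^*}^2\,ds+2c_1|u(t)|_H^2\le M_1,\qquad \int_0^t|\mu(s)|_V^2\,ds\le M_1,$$ $$\int_0^t|\beta(u(s))|_V^2\,ds\le 2\bigl(M_1+|f|_{L^2(0,T;V)}^2\bigr).$$ -/

import Mathlib

open MeasureTheory Set
open scoped ContDiff ENNReal

namespace PorousMedium

noncomputable section

/-- The Euclidean space `ℝ^N`. -/
abbrev RN (N : ℕ) : Type := EuclideanSpace ℝ (Fin N)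

/-- `φ ∈ C_c^∞(Ω)`: a smooth real function with compact support contained in `Ω`. -/
def IsTestFunction {X : Type*} [NormedAddCommGroup X] [NormedSpace ℝ X]
    (Ω : Set X) (φ : X → ℝ) : Prop :=
  ContDiff ℝ ∞ φ ∧ HasCompactSupport φ ∧ tsupport φ ⊆ Ω

/-! ### The spaces `H = L²(Ω)`, `V = H¹(Ω)`, `V*` -/

/-- `H = L²(Ω)`. -/
abbrev SpaceH {N : ℕ} (Ω : Set (RN N)) : Type := Lp ℝ 2 (volume.restrict Ω)

/-- `L²(Ω; ℝ^N)`. -/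
abbrev SpaceHvec {N : ℕ} (Ω : Set (RN N)) : Type := Lp (RN N) 2 (volume.restrict Ω)

/-- `G` is the weak gradient of `v` in `Ω`:
`∫_Ω v ∂_e φ = - ∫_Ω φ (G · e)` for all test functions `φ` and all directions `e`. -/
def HasWeakGradient {N : ℕ} (Ω : Set (RN N)) (v : RN N → ℝ) (G : RN N → RN N) : Prop :=
  ∀ φ : RN N → ℝ, IsTestFunction Ω φ → ∀ e : RN N,
    ∫ x in Ω, v x * fderiv ℝ φ x e = - ∫ x in Ω, φ x * inner ℝ (G x) e

lemma IsTestFunction.memLp {N : ℕ} {Ω : Set (RN N)} {φ : RN N → ℝ}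
    (h : IsTestFunction Ω φ) : MemLp φ 2 (volume.restrict Ω) :=
  (h.1.continuous.memLp_of_hasCompactSupport (μ := volume) h.2.1).restrict Ω

lemma IsTestFunction.memLp_fderiv {N : ℕ} {Ω : Set (RN N)} {φ : RN N → ℝ}
    (h : IsTestFunction Ω φ) (e : RN N) :
    MemLp (fun x => fderiv ℝ φ x e) 2 (volume.restrict Ω) := by
  have hc : Continuous (fun x => fderiv ℝ φ x e) :=
    (h.1.continuous_fderiv (by simp)).clm_apply continuous_const
  have hs : HasCompactSupport (fun x => fderiv ℝ φ x e) := h.2.1.fderiv_apply ℝ e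
  exact (hc.memLp_of_hasCompactSupport (μ := volume) hs).restrict Ω

lemma integrable_mul_fderiv {N : ℕ} {Ω : Set (RN N)} {φ : RN N → ℝ}
    (h : IsTestFunction Ω φ) (e : RN N) (v : SpaceH Ω) :
    Integrable (fun x => v x * fderiv ℝ φ x e) (volume.restrict Ω) :=
  (Lp.memLp v).integrable_mul (h.memLp_fderiv e)

lemma integrable_mul_inner {N : ℕ} {Ω : Set (RN N)} {φ : RN N → ℝ}
    (h : IsTestFunction Ω φ) (e : RN N) (G : SpaceHvec Ω) :
    Integrable (fun x => φ x * inner ℝ (G x) e) (volume.restrict Ω) :=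
  h.memLp.integrable_mul ((Lp.memLp G).inner_const e)

/-- `V = H¹(Ω)`, realized as the space of pairs `(v, ∇v)` in `L²(Ω) × L²(Ω; ℝ^N)`, where `∇v` is
the weak gradient of `v`. As a subspace of the Hilbert product it carries the inner product
`(v, w)_V = ∫_Ω v w + ∫_Ω ∇v · ∇w` and the corresponding norm. -/
def sobolevH1 {N : ℕ} (Ω : Set (RN N)) :
    Submodule ℝ (WithLp 2 (SpaceH Ω × SpaceHvec Ω)) where
  carrier := {p | HasWeakGradient Ω p.fst p.snd}
  zero_mem' := by
    intro φ _ e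
    have h1 : ∫ x in Ω, (0 : SpaceH Ω) x * fderiv ℝ φ x e = 0 := by
      refine integral_eq_zero_of_ae ?_
      filter_upwards [Lp.coeFn_zero ℝ 2 (volume.restrict Ω)] with x hx
      exact (congrArg (· * fderiv ℝ φ x e) hx).trans (zero_mul _)
    have h2 : ∫ x in Ω, φ x * inner ℝ ((0 : SpaceHvec Ω) x) e = 0 := by
      refine integral_eq_zero_of_ae ?_
      filter_upwards [Lp.coeFn_zero (RN N) 2 (volume.restrict Ω)] with x hx
      exact (congrArg (fun y => φ x * inner ℝ y e) hx).trans (by simp)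
    exact h1.trans (by rw [WithLp.zero_snd, h2, neg_zero])
  add_mem' := by
    intro p q hp hq φ hφ e
    have h1 : ∫ x in Ω, ((p.fst + q.fst : SpaceH Ω) : RN N → ℝ) x * fderiv ℝ φ x e
        = (∫ x in Ω, p.fst x * fderiv ℝ φ x e) + ∫ x in Ω, q.fst x * fderiv ℝ φ x e := by
      rw [← integral_add (integrable_mul_fderiv hφ e _) (integrable_mul_fderiv hφ e _)]
      refine integral_congr_ae ?_
      filter_upwards [Lp.coeFn_add p.fst q.fst] with x hx
      rw [hx, Pi.add_apply, add_mul]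
    have h2 : ∫ x in Ω, φ x * inner ℝ (((p.snd + q.snd : SpaceHvec Ω) : RN N → RN N) x) e
        = (∫ x in Ω, φ x * inner ℝ (p.snd x) e) + ∫ x in Ω, φ x * inner ℝ (q.snd x) e := by
      rw [← integral_add (integrable_mul_inner hφ e _) (integrable_mul_inner hφ e _)]
      refine integral_congr_ae ?_
      filter_upwards [Lp.coeFn_add p.snd q.snd] with x hx
      rw [hx, Pi.add_apply, inner_add_left, mul_add]
    have h3 := hp φ hφ e
    have h4 := hq φ hφ e
    simp only [WithLp.add_fst, WithLp.add_snd]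
    rw [h1, h2, h3, h4]
    ring
  smul_mem' := by
    intro c p hp φ hφ e
    have h1 : ∫ x in Ω, ((c • p.fst : SpaceH Ω) : RN N → ℝ) x * fderiv ℝ φ x e
        = c * ∫ x in Ω, p.fst x * fderiv ℝ φ x e := by
      rw [← integral_const_mul]
      refine integral_congr_ae ?_
      filter_upwards [Lp.coeFn_smul c p.fst] with x hx
      rw [hx, Pi.smul_apply, smul_eq_mul, mul_assoc]
    have h2 : ∫ x in Ω, φ x * inner ℝ (((c • p.snd : SpaceHvec Ω) : RN N → RN N) x) e
        = c * ∫ x in Ω, φ x * inner ℝ (p.snd x) e := by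
      rw [← integral_const_mul]
      refine integral_congr_ae ?_
      filter_upwards [Lp.coeFn_smul c p.snd] with x hx
      rw [hx, Pi.smul_apply, real_inner_smul_left, mul_left_comm]
    have h3 := hp φ hφ e
    simp only [WithLp.smul_fst, WithLp.smul_snd]
    rw [h1, h2, h3]
    ring

/-- `V = H¹(Ω)`. -/
abbrev SpaceV {N : ℕ} (Ω : Set (RN N)) : Type := sobolevH1 Ω

/-- The dual space `V*`. Its operator norm is the norm of the inner product
`(v*, w*)_{V*} = ⟨v*, F⁻¹ w*⟩`, where `F : V → V*`, `⟨F v, w⟩ = (v, w)_V`, is the Riesz map. -/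
abbrev SpaceVdual {N : ℕ} (Ω : Set (RN N)) : Type := StrongDual ℝ (SpaceV Ω)

/-- The embedding `V → H`: the function in `L²(Ω)` underlying an element of `H¹(Ω)`. -/
def toH {N : ℕ} {Ω : Set (RN N)} : SpaceV Ω →L[ℝ] SpaceH Ω :=
  (WithLp.fstL 2 ℝ (SpaceH Ω) (SpaceHvec Ω)).comp (sobolevH1 Ω).subtypeL

/-- The weak gradient of an element of `H¹(Ω)`. -/
def grad {N : ℕ} {Ω : Set (RN N)} : SpaceV Ω →L[ℝ] SpaceHvec Ω :=
  (WithLp.sndL 2 ℝ (SpaceH Ω) (SpaceHvec Ω)).comp (sobolevH1 Ω).subtypeL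

/-- The embedding `H → V*`: `⟨h, z⟩_{V*,V} = (h, z)_H`. -/
def toVdual {N : ℕ} {Ω : Set (RN N)} (h : SpaceH Ω) : SpaceVdual Ω :=
  (innerSL ℝ h).comp toH

/-! ### Functions of time -/

/-- Lebesgue measure on `(0, T)`. -/
abbrev timeMeasure (T : ℝ) : Measure ℝ := volume.restrict (Ioo 0 T)

/-- `u'` is the weak derivative of `u` on `(0, T)`: `∫₀ᵀ φ' u = - ∫₀ᵀ φ u'` for all
`φ ∈ C_c^∞(0, T)` (Bochner integrals). -/
def HasWeakTimeDeriv {X : Type*} [NormedAddCommGroup X] [NormedSpace ℝ X]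
    (T : ℝ) (u u' : ℝ → X) : Prop :=
  ∀ φ : ℝ → ℝ, IsTestFunction (Ioo 0 T) φ →
    ∫ t in Ioo 0 T, deriv φ t • u t = - ∫ t in Ioo 0 T, φ t • u' t

/-! ### The hypotheses -/

/-- The (single-valued) operator `β` on `ℝ` is maximal monotone: its graph is monotone and has no
proper monotone extension. -/
def IsMaximalMonotone (β : ℝ → ℝ) : Prop :=
  (∀ r s, 0 ≤ (β r - β s) * (r - s)) ∧
    ∀ r y, (∀ s, 0 ≤ (y - β s) * (r - s)) → y = β r

/-- The subdifferential of a convex function on `ℝ`. -/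
def subdifferential (j : ℝ → ℝ) (r : ℝ) : Set ℝ :=
  {y | ∀ s, y * (s - r) ≤ j s - j r}

/-- The assumptions on `β`, on its primitive `βhat` and on the constant `c₁`. -/
structure BetaAssumptions {N : ℕ} (Ω : Set (RN N)) (β βhat : ℝ → ℝ) (c₁ : ℝ) : Prop where
  maximalMonotone : IsMaximalMonotone β
  convex : ConvexOn ℝ univ βhat
  nonneg : ∀ r, 0 ≤ βhat r
  map_zero : βhat 0 = 0
  hasDerivAt : ∀ r, HasDerivAt βhat (β r) r
  subdifferential_eq : ∀ r, subdifferential βhat r = {β r}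
  c₁_pos : 0 < c₁
  quadratic_growth : ∀ r, c₁ * |r| ^ 2 ≤ βhat r
  locallyIntegrable : ∀ z : SpaceH Ω,
    Integrable (fun x => βhat (z x)) (volume.restrict Ω) →
      LocallyIntegrableOn (fun x => β (z x)) Ω volume
  integrable_add : ∀ z : SpaceH Ω, ∀ ψ : RN N → ℝ, IsTestFunction Ω ψ →
    Integrable (fun x => βhat (z x)) (volume.restrict Ω) →
      Integrable (fun x => βhat (z x + ψ x)) (volume.restrict Ω)

/-- `f(t)` is, for a.e. `t ∈ (0, T)`, the (weak) solution in `H¹(Ω)` of the Neumann problem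
`(-Δ + 1) f(t) = g(t)` in `Ω`, `∂_ν f(t) = 0` on `∂Ω`. -/
def SolvesNeumann {N : ℕ} {Ω : Set (RN N)} (T : ℝ) (f : ℝ → SpaceV Ω) (g : ℝ → SpaceH Ω) : Prop :=
  ∀ᵐ t ∂timeMeasure T, ∀ z : SpaceV Ω,
    (∫ x in Ω, inner ℝ (grad (f t) x) (grad z x)) + ∫ x in Ω, toH (f t) x * toH z x
      = ∫ x in Ω, g t x * toH z x

/-! ### Weak solutions -/

/-- `(u, μ)`, with `u ∈ L^∞(0,T;H)` and `μ ∈ L²(0,T;V)`, is a weak solution of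
`∂u/∂t + (-Δ + 1) β(u) = g` in `Ω × (0,T)`, `∂_ν β(u) = 0` on `∂Ω × (0,T)`, `u(0) = u₀`, where
`f` is the solution of `(-Δ + 1) f = g`, `∂_ν f = 0`. -/
structure IsWeakSolution {N : ℕ} {Ω : Set (RN N)} (T : ℝ) (β : ℝ → ℝ)
    (f : Lp (SpaceV Ω) 2 (timeMeasure T)) (u₀ : SpaceH Ω)
    (u : Lp (SpaceH Ω) ∞ (timeMeasure T)) (μ : Lp (SpaceV Ω) 2 (timeMeasure T)) : Prop where
  /-- `u ∈ H¹(0,T;V*)` with derivative `u'`, and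
  `⟨u'(t), z⟩ + (μ(t), z)_V = 0` for all `z ∈ V` and a.e. `t`. -/
  equation : ∃ u' : Lp (SpaceVdual Ω) 2 (timeMeasure T),
    HasWeakTimeDeriv T (fun t => toVdual (u t)) u' ∧
      ∀ᵐ t ∂timeMeasure T, ∀ z : SpaceV Ω, u' t z + inner ℝ (μ t) z = 0
  /-- `μ(t) = β(u(t)) - f(t)` for a.e. `t`; in particular `β(u(t)) ∈ V`. -/
  constitutive : ∀ᵐ t ∂timeMeasure T, ∀ᵐ x ∂volume.restrict Ω,
    toH (μ t) x = β (u t x) - toH (f t) x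
  /-- `u(0) = u₀`, for the representative `U` of `u` in `C([0,T];V*)`. -/
  initial : ∃ U : ℝ → SpaceVdual Ω, ContinuousOn U (Icc 0 T) ∧
    (∀ᵐ t ∂timeMeasure T, U t = toVdual (u t)) ∧ U 0 = toVdual u₀

end

end PorousMedium

/-!
# Well-posedness of a porous medium type equation as an evolution in `H¹(Ω)*`

Write `i : V → H` for the embedding `H¹(Ω) → L²(Ω)`, `i*` for its adjoint and `F` for the Riesz map
of `V`. The embedding `H → V*` is `F ∘ i*`, so after applying `F⁻¹` a weak solution is a pair
`(u, μ)` with `i* u(t) = i* u₀ - ∫₀ᵗ μ` and `β(u) = i (μ + f)` almost everywhere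
(`IsWeakSolution.adjoint_eq`, which rests on the lemma of du Bois-Reymond, and
`IsWeakSolution.graph`). Test functions lie in `V`, hence `i*` is injective
(`eq_zero_of_adjoint_toH_eq_zero`). The dual space `V*` plays no further role.

*Uniqueness* (`eq_zero_of_monotone`). For the difference `(w, m)` of two solutions,
`i* w = -∫₀ᵗ m` and `(i* w, m)_V = (w, i m)_H ≥ 0` by monotonicity of `β`, while
`∫₀ᵗ (m, ∫₀ˢ m) ds = ½ |∫₀ᵗ m|²`; hence `∫₀ᵗ m = 0`, `i* w = 0` and `w = 0`.

*Existence* (`exists_evolution`) is proved for a monotone graph in a Hilbert space. Replace `β` by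
its Yosida approximation `B = β_λ`, the inverse of `i i*` by that of `i i* + λ`, and `f` by a
continuous function. This gives the ordinary differential equation `u' = -v`, `(i i* + λ) v = B(u) - i f` with
a Lipschitz right-hand side on `H`. Its solutions obey, with `m = i* v` and `E` the Moreau envelope
of the energy `∫ βhat`,
`∫₀ᵗ |m|² + 2 λ ∫₀ᵗ |v|² + 2 E(u(t)) ≤ 2 E(u₀) + ∫₀ᵗ |f|²` (`exists_regularized_solution`). These
bounds have the sharp constants, because `E ≤ ∫ βhat` and `E ≥ c₁ / (1 + 2 λ c₁) |·|²`, and they are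
weakly lower semicontinuous. Let `λ → 0` along a nonprincipal ultrafilter, so that all bounded
sequences, including `u(t)` for each single `t`, converge weakly. The linear relation passes to the
limit by Fubini's theorem (`primitive_of_weak_limit`). The nonlinear one follows by Minty's argument
(`graph_of_weak_limit`), in which `limsup ∫ (u, B(u)) ≤ ∫ (u, i (m + f))` comes from the energy
identity `∫ (u, i m) = (i* u₀, M) - ½ |M|²`, `M = ∫ m` (`inner_compLp_of_primitive`) and weak lower
semicontinuity of the norm. Maximality of the Nemytskii operator of `β` enters only through its
resolvent, which is the Nemytskii operator of the scalar resolvent (`exists_isYosida_nemytskii`).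

The estimates hold for the constructed solution, and by uniqueness it is the only one.
-/

open MeasureTheory Set
open scoped ContDiff ENNReal

namespace PorousMedium

open Filter Topology

/-! ### Ordinary differential equations with a Lipschitz right-hand side -/

/-- A Lipschitz differential equation is solvable on every interval of length `h ≤ 1 / (2 K)`,
whatever the initial value: on the ball of radius `2 C h` around `x` the field is bounded by `2 C`,
where `C` bounds `F(t, x)`. -/
theorem exists_integral_curve_step {E : Type*} [NormedAddCommGroup E] [NormedSpace ℝ E]
    [CompleteSpace E] {F : ℝ → E → E} {K : NNReal} (hF : ∀ t, LipschitzWith K (F t))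
    (hc : Continuous (Function.uncurry F)) {a h : ℝ} (hh : 0 ≤ h) (hK : 2 * (K * h) ≤ 1) (x : E) :
    ∃ v : ℝ → E, v a = x ∧ ContinuousOn v (Icc a (a + h)) ∧
      ∀ t ∈ Icc a (a + h), v t = x + ∫ s in a..t, F s (v s) := by
  obtain ⟨C, hC⟩ : ∃ C : ℝ, ∀ t ∈ Icc a (a + h), ‖F t x‖ ≤ C :=
    isCompact_Icc.exists_bound_of_continuousOn
      (hc.comp (Continuous.prodMk continuous_id continuous_const)).continuousOn
  have hC0 : 0 ≤ C := (norm_nonneg _).trans (hC a ⟨le_rfl, by linarith⟩)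
  have hp : IsPicardLindelof F (tmin := a) (tmax := a + h) ⟨a, le_rfl, by linarith⟩ x
      (⟨2 * C * h, by positivity⟩ : NNReal) 0
      (⟨C + K * (2 * C * h), by positivity⟩ : NNReal) K := by
    refine ⟨fun t _ => (hF t).lipschitzOnWith, fun y _ =>
      (hc.comp (Continuous.prodMk continuous_id continuous_const)).continuousOn, ?_, ?_⟩
    · intro t ht y hy
      have h1 : ‖F t y - F t x‖ ≤ K * (2 * C * h) := by
        rw [← dist_eq_norm]
        refine ((hF t).dist_le_mul y x).trans ?_
        gcongr
        exact hy
      calc ‖F t y‖ = ‖F t x + (F t y - F t x)‖ := by congr 1; abel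
        _ ≤ ‖F t x‖ + ‖F t y - F t x‖ := norm_add_le _ _
        _ ≤ C + K * (2 * C * h) := add_le_add (hC t ht) h1
    · have e : max (a + h - a) (a - a) = h := by simp [hh]
      rw [NNReal.coe_zero, sub_zero, e]
      change (C + K * (2 * C * h)) * h ≤ 2 * C * h
      nlinarith [mul_nonneg hC0 hh]
  obtain ⟨v, hv0, hv⟩ := hp.exists_eq_forall_mem_Icc_hasDerivWithinAt₀
  have hcont : ContinuousOn v (Icc a (a + h)) := fun t ht => (hv t ht).continuousWithinAt
  refine ⟨v, hv0, hcont, fun t ht => ?_⟩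
  have hFv : ContinuousOn (fun s => F s (v s)) (Icc a (a + h)) :=
    hc.comp_continuousOn (continuousOn_id.prodMk hcont)
  have hsub : Icc a t ⊆ Icc a (a + h) := Icc_subset_Icc_right ht.2
  have := intervalIntegral.integral_eq_sub_of_hasDeriv_right_of_le ht.1 (hcont.mono hsub)
    (f' := fun s => F s (v s))
    (fun s hs => ((hv s (hsub ⟨hs.1.le, hs.2.le⟩)).hasDerivAt
      (Icc_mem_nhds hs.1 (hs.2.trans_le ht.2))).hasDerivWithinAt)
    ((hFv.mono hsub).intervalIntegrable_of_Icc ht.1)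
  rw [this, show v a = x from hv0]
  abel

/-- Global solvability of `u' = F(t, u)`, `u(0) = x` on `[0, T]` for a globally Lipschitz `F`. The
solution and its derivative are returned as functions on the whole line; the equation is only
claimed on `[0, T]`. -/
theorem exists_global_solution {E : Type*} [NormedAddCommGroup E] [NormedSpace ℝ E]
    [CompleteSpace E] {F : ℝ → E → E} {K : NNReal} (hF : ∀ t, LipschitzWith K (F t))
    (hc : Continuous (Function.uncurry F)) (T : ℝ) (x : E) :
    ∃ u u' : ℝ → E, Continuous u' ∧ u 0 = x ∧ (∀ t, HasDerivAt u (u' t) t) ∧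
      ∀ t ∈ Icc 0 T, u' t = F t (u t) := by
  obtain ⟨h, hh, hK⟩ : ∃ h : ℝ, 0 < h ∧ 2 * (K * h) ≤ 1 := by
    refine ⟨1 / (2 * (K + 1)), by positivity, ?_⟩
    rw [mul_one_div, ← mul_div_assoc, div_le_one (by positivity)]
    linarith
  -- Solutions of the integral equation on `[0, n h]`, by gluing local solutions.
  have key : ∀ n : ℕ, ∃ u : ℝ → E, Continuous u ∧
      ∀ t ∈ Icc 0 (n * h), u t = x + ∫ s in (0 : ℝ)..t, F s (u s) := by
    intro n
    induction n with
    | zero =>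
      refine ⟨fun _ => x, continuous_const, fun t ht => ?_⟩
      have : t = 0 := le_antisymm (by simpa using ht.2) ht.1
      simp [this]
    | succ n ih =>
      obtain ⟨u, hu, hu'⟩ := ih
      set a : ℝ := n * h with ha
      have ha0 : 0 ≤ a := by positivity
      obtain ⟨v, hva, hvc, hv⟩ := exists_integral_curve_step hF hc (a := a) hh.le hK (u a)
      let w : ℝ → E := fun t => u (min t a) + (v (projIcc a (a + h) (by linarith) t) - u a)
      have hw : Continuous w := by
        refine (hu.comp (by fun_prop)).add (Continuous.sub ?_ continuous_const)
        exact hvc.comp_continuous (continuous_subtype_val.comp continuous_projIcc)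
          (fun t => Subtype.coe_prop _)
      have hw1 : ∀ t ≤ a, w t = u t := by
        intro t ht
        simp only [w, projIcc_of_le_left (show a ≤ a + h by linarith) ht, min_eq_left ht, hva]
        abel
      have hw2 : ∀ t ∈ Icc a (a + h), w t = v t := by
        intro t ht
        simp only [w, projIcc_of_mem (show a ≤ a + h by linarith) ht, min_eq_right ht.1]
        abel
      have hFw : Continuous (fun s => F s (w s)) := hc.comp (continuous_id.prodMk hw)
      refine ⟨w, hw, fun t ht => ?_⟩
      rcases le_total t a with h1 | h1
      · rw [hw1 t h1, hu' t ⟨ht.1, h1⟩]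
        congr 1
        refine intervalIntegral.integral_congr fun s hs => ?_
        rw [uIcc_of_le ht.1] at hs
        simp only [hw1 s (hs.2.trans h1)]
      · have h2 : t ∈ Icc a (a + h) := ⟨h1, ht.2.trans_eq (by rw [ha]; push_cast; ring)⟩
        rw [hw2 t h2, hv t h2, hu' a ⟨ha0, le_rfl⟩,
          ← intervalIntegral.integral_add_adjacent_intervals
            (hFw.intervalIntegrable 0 a) (hFw.intervalIntegrable a t), add_assoc]
        congr 2
        · refine intervalIntegral.integral_congr fun s hs => ?_
          rw [uIcc_of_le ha0] at hs
          simp only [hw1 s hs.2]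
        · refine intervalIntegral.integral_congr fun s hs => ?_
          rw [uIcc_of_le h1] at hs
          simp only [hw2 s ⟨hs.1, hs.2.trans h2.2⟩]
  obtain ⟨n, hn⟩ := exists_nat_ge (T / h)
  obtain ⟨w, hw, hw'⟩ := key n
  have hFw : Continuous (fun s => F s (w s)) := hc.comp (continuous_id.prodMk hw)
  refine ⟨fun t => x + ∫ s in (0 : ℝ)..t, F s (w s), fun t => F t (w t), hFw, by simp,
    fun t => ?_, fun t ht => ?_⟩
  · exact (intervalIntegral.integral_hasDerivAt_right (hFw.intervalIntegrable _ _)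
      (hFw.stronglyMeasurableAtFilter _ _) hFw.continuousAt).const_add x
  · simp only [← hw' t ⟨ht.1, ht.2.trans ((div_le_iff₀ hh).1 hn)⟩]

/-! ### Weak sequential limits along an ultrafilter -/

/-- Bounded sequences in a Hilbert space converge weakly along every ultrafilter. Working along one
fixed ultrafilter makes all the sequences of the approximation scheme converge simultaneously,
without extraction of subsequences. -/
theorem exists_weak_limit {X : Type*} [NormedAddCommGroup X] [InnerProductSpace ℝ X]
    [CompleteSpace X] (l : Ultrafilter ℕ) {x : ℕ → X} {C : ℝ} (hx : ∀ n, ‖x n‖ ≤ C) :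
    ∃ y : X, ∀ z : X, Tendsto (fun n => inner ℝ (x n) z) l (𝓝 (inner ℝ y z)) := by
  have hK := WeakDual.isCompact_closedBall (𝕜 := ℝ) (0 : StrongDual ℝ X) C
  let ψ : ℕ → WeakDual ℝ X := fun n => StrongDual.toWeakDual (InnerProductSpace.toDual ℝ X (x n))
  have hle : ((l.map ψ : Ultrafilter _) : Filter (WeakDual ℝ X)) ≤
      𝓟 (WeakDual.toStrongDual ⁻¹' Metric.closedBall (0 : StrongDual ℝ X) C) := by
    rw [le_principal_iff]
    refine Filter.Eventually.of_forall (f := (l : Filter ℕ)) fun n => ?_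
    simpa [ψ] using hx n
  obtain ⟨φ, -, hφ⟩ := hK.ultrafilter_le_nhds _ hle
  refine ⟨(InnerProductSpace.toDual ℝ X).symm (WeakDual.toStrongDual φ), fun z => ?_⟩
  have h1 : Tendsto ψ l (𝓝 φ) := hφ
  have h2 := ((WeakDual.eval_continuous z).tendsto φ).comp h1
  simpa [ψ, Function.comp_def] using h2

theorem tendsto_inner_zero {X : Type*} [NormedAddCommGroup X] [InnerProductSpace ℝ X]
    {l : Filter ℕ} {x y : ℕ → X} {C : ℝ} (hx : ∀ n, ‖x n‖ ≤ C) (hy : Tendsto y l (𝓝 0)) :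
    Tendsto (fun n => inner ℝ (x n) (y n)) l (𝓝 0) := by
  have h : Tendsto (fun n => C * ‖y n‖) l (𝓝 0) := by simpa using hy.norm.const_mul C
  refine squeeze_zero_norm (fun n => ?_) h
  exact (norm_inner_le_norm _ _).trans (by gcongr; exact hx n)

theorem integrable_inner_of_memLp {α V : Type*} [MeasurableSpace α] {ν : Measure α}
    [NormedAddCommGroup V] [InnerProductSpace ℝ V] {f g : α → V}
    (hf : MemLp f 2 ν) (hg : MemLp g 2 ν) : Integrable (fun t => inner ℝ (f t) (g t)) ν :=
  (L2.integrable_inner (𝕜 := ℝ) hf.toLp hg.toLp).congr (by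
    filter_upwards [hf.coeFn_toLp, hg.coeFn_toLp] with t h1 h2
    rw [h1, h2])

/-! ### Primitives of integrable functions -/

section Primitives

variable {E F G : Type*} [NormedAddCommGroup E] [NormedSpace ℝ E] [CompleteSpace E]
  [NormedAddCommGroup F] [NormedSpace ℝ F]
  [NormedAddCommGroup G] [NormedSpace ℝ G] [CompleteSpace G]
  {ν : Measure ℝ}

/-- Integration by parts for primitives, a form of Fubini's theorem. -/
theorem integral_bilin_primitive [CompleteSpace F] [SFinite ν] (L : E →L[ℝ] F →L[ℝ] G)
    {g : ℝ → E} {m : ℝ → F}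
    (hg : Integrable g ν) (hm : Integrable m ν) :
    ∫ t, L (g t) (∫ s in Iio t, m s ∂ν) ∂ν = ∫ s, L (∫ t in Ioi s, g t ∂ν) (m s) ∂ν := by
  have hS : MeasurableSet {p : ℝ × ℝ | p.2 < p.1} :=
    (isOpen_lt continuous_snd continuous_fst).measurableSet
  have hint : Integrable (fun p : ℝ × ℝ => L (g p.1) (m p.2)) (ν.prod ν) :=
    hg.op_fst_snd (by fun_prop) ⟨‖L‖, L.le_opNorm₂⟩ hm
  have hind := hint.indicator hS
  calc ∫ t, L (g t) (∫ s in Iio t, m s ∂ν) ∂ν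
      = ∫ t, ∫ s, {p : ℝ × ℝ | p.2 < p.1}.indicator (fun p => L (g p.1) (m p.2)) (t, s) ∂ν ∂ν := by
        refine integral_congr_ae (Eventually.of_forall fun t => ?_)
        simp only
        rw [← ContinuousLinearMap.integral_comp_comm _ hm.restrict,
          ← integral_indicator measurableSet_Iio]
        rfl
    _ = ∫ s, ∫ t, {p : ℝ × ℝ | p.2 < p.1}.indicator (fun p => L (g p.1) (m p.2)) (t, s) ∂ν ∂ν :=
        integral_integral_swap hind
    _ = _ := by
        refine integral_congr_ae (Eventually.of_forall fun s => ?_)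
        simp only
        rw [← L.flip_apply, ← ContinuousLinearMap.integral_comp_comm _ hg.restrict,
          ← integral_indicator measurableSet_Ioi]
        rfl

/-- Primitives of integrable functions are bounded, hence in every `Lᵖ` of a finite measure. -/
theorem memLp_primitive_Iio [IsFiniteMeasure ν] {m : ℝ → F} (hm : Integrable m ν)
    (p : ℝ≥0∞) : MemLp (fun t => ∫ s in Iio t, m s ∂ν) p ν := by
  have hS : MeasurableSet {p : ℝ × ℝ | p.2 < p.1} :=
    (isOpen_lt continuous_snd continuous_fst).measurableSet
  have hmeas : AEStronglyMeasurable (fun t => ∫ s in Iio t, m s ∂ν) ν := by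
    have : AEStronglyMeasurable
        ({p : ℝ × ℝ | p.2 < p.1}.indicator (fun p => m p.2)) (ν.prod ν) :=
      (hm.1.comp_snd).indicator hS
    refine this.integral_prod_right'.congr (Eventually.of_forall fun t => ?_)
    simp only
    rw [← integral_indicator measurableSet_Iio]
    rfl
  refine MemLp.of_bound hmeas (∫ s, ‖m s‖ ∂ν) (Eventually.of_forall fun t => ?_)
  exact (norm_integral_le_integral_norm _).trans
    (setIntegral_le_integral hm.norm (Eventually.of_forall fun _ => norm_nonneg _))

theorem memLp_primitive_Ioi [IsFiniteMeasure ν] {m : ℝ → F} (hm : Integrable m ν)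
    (p : ℝ≥0∞) : MemLp (fun t => ∫ s in Ioi t, m s ∂ν) p ν := by
  have hS : MeasurableSet {p : ℝ × ℝ | p.1 < p.2} :=
    (isOpen_lt continuous_fst continuous_snd).measurableSet
  have hmeas : AEStronglyMeasurable (fun t => ∫ s in Ioi t, m s ∂ν) ν := by
    have : AEStronglyMeasurable
        ({p : ℝ × ℝ | p.1 < p.2}.indicator (fun p => m p.2)) (ν.prod ν) :=
      (hm.1.comp_snd).indicator hS
    refine this.integral_prod_right'.congr (Eventually.of_forall fun t => ?_)
    simp only
    rw [← integral_indicator measurableSet_Ioi]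
    rfl
  refine MemLp.of_bound hmeas (∫ s, ‖m s‖ ∂ν) (Eventually.of_forall fun t => ?_)
  exact (norm_integral_le_integral_norm _).trans
    (setIntegral_le_integral hm.norm (Eventually.of_forall fun _ => norm_nonneg _))

/-- The energy identity `∫ (m, y) = ½ |∫ m|²` for the primitive `y` of `m`. -/
theorem integral_inner_primitive {V : Type*} [NormedAddCommGroup V] [InnerProductSpace ℝ V]
    [CompleteSpace V] [IsFiniteMeasure ν] [NullSingletonClass ν] {m : ℝ → V} (hm : MemLp m 2 ν) :
    ∫ t, inner ℝ (m t) (∫ s in Iio t, m s ∂ν) ∂ν = ‖∫ t, m t ∂ν‖ ^ 2 / 2 := by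
  have hi : Integrable m ν := hm.integrable (by norm_num)
  have h1 : ∫ t, inner ℝ (m t) (∫ s in Iio t, m s ∂ν) ∂ν
      = ∫ s, inner ℝ (∫ t in Ioi s, m t ∂ν) (m s) ∂ν :=
    integral_bilin_primitive (innerSL ℝ) hi hi
  have h2 : ∀ s, ∫ t in Ioi s, m t ∂ν = (∫ t, m t ∂ν) - ∫ t in Iio s, m t ∂ν := by
    intro s
    rw [← integral_add_compl (measurableSet_Iio (a := s)) hi, compl_Iio,
      integral_Ici_eq_integral_Ioi]
    abel
  have hint : Integrable (fun s => inner ℝ (∫ t in Iio s, m t ∂ν) (m s)) ν :=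
    integrable_inner_of_memLp (memLp_primitive_Iio hi 2) hm
  have h3 : ∫ s, inner ℝ (∫ t in Ioi s, m t ∂ν) (m s) ∂ν
      = ‖∫ t, m t ∂ν‖ ^ 2 - ∫ s, inner ℝ (∫ t in Iio s, m t ∂ν) (m s) ∂ν := by
    simp only [h2, inner_sub_left]
    rw [integral_sub (hi.const_inner _) hint, integral_inner hi, real_inner_self_eq_norm_sq]
  rw [h3] at h1
  have h4 : ∫ s, inner ℝ (∫ t in Iio s, m t ∂ν) (m s) ∂ν
      = ∫ t, inner ℝ (m t) (∫ s in Iio t, m s ∂ν) ∂ν :=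
    integral_congr_ae (Eventually.of_forall fun t => real_inner_comm _ _)
  linarith

end Primitives

/-! ### Monotone graphs and the regularized evolution -/

section Abstract

variable {H V : Type*} [NormedAddCommGroup H] [InnerProductSpace ℝ H]
  [NormedAddCommGroup V] [InnerProductSpace ℝ V]

/-- The graph `G` of a (possibly multivalued) operator on a Hilbert space is monotone. -/
def IsMonotoneGraph (G : H → H → Prop) : Prop :=
  ∀ ⦃x y x' y' : H⦄, G x y → G x' y' → 0 ≤ inner ℝ (x - x') (y - y')

/-- `B` is the Yosida approximation with parameter `l` of the operator with graph `G`, and it is the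
gradient of `E`. The first property says that `x - l B(x)` is the resolvent `(1 + l G)⁻¹ x`. -/
structure IsYosida (G : H → H → Prop) (l : ℝ) (B : H → H) (E : H → ℝ) : Prop where
  pos : 0 < l
  mem : ∀ x, G (x - l • B x) (B x)
  hasFDerivAt : ∀ x, HasFDerivAt E (innerSL ℝ (B x)) x

theorem IsYosida.lipschitzWith {G : H → H → Prop} (hG : IsMonotoneGraph G) {l : ℝ} {B : H → H}
    {E : H → ℝ} (h : IsYosida G l B E) : LipschitzWith (Real.toNNReal l⁻¹) B := by
  refine LipschitzWith.of_dist_le' fun x y => ?_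
  rw [dist_eq_norm, dist_eq_norm]
  have h1 := hG (h.mem x) (h.mem y)
  have e : x - l • B x - (y - l • B y) = (x - y) - l • (B x - B y) := by module
  rw [e, inner_sub_left, real_inner_smul_left, real_inner_self_eq_norm_sq] at h1
  have h2 := real_inner_le_norm (x - y) (B x - B y)
  have h3 : l * ‖B x - B y‖ ≤ ‖x - y‖ := by
    rcases (norm_nonneg (B x - B y)).eq_or_lt with h0 | h0
    · rw [← h0]; simp
    · refine le_of_mul_le_mul_right ?_ h0
      nlinarith
  rw [inv_mul_eq_div, le_div_iff₀ h.pos, mul_comm]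
  exact h3

/-- The resolvent `R = (1 + G)⁻¹` of a monotone graph is nonexpansive. -/
theorem IsMonotoneGraph.lipschitzWith_resolvent {G : H → H → Prop} (hG : IsMonotoneGraph G)
    {R : H → H} (hR : ∀ x, G (R x) (x - R x)) : LipschitzWith 1 R := by
  refine LipschitzWith.of_dist_le_mul fun x y => ?_
  rw [dist_eq_norm, dist_eq_norm, NNReal.coe_one, one_mul]
  have h1 := hG (hR x) (hR y)
  have e : x - R x - (y - R y) = (x - y) - (R x - R y) := by module
  rw [e, inner_sub_right, real_inner_self_eq_norm_sq] at h1
  have h2 := real_inner_le_norm (R x - R y) (x - y)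
  rcases (norm_nonneg (R x - R y)).eq_or_lt with h0 | h0
  · rw [← h0]; positivity
  · refine le_of_mul_le_mul_right ?_ h0
    nlinarith

variable [CompleteSpace H] [CompleteSpace V]

/-- `i i* + l` is invertible, by the Lax-Milgram theorem. -/
theorem exists_inverse_adjoint_add_smul (i : V →L[ℝ] H) {l : ℝ} (hl : 0 < l) :
    ∃ A : H →L[ℝ] H, ∀ x, i (i.adjoint (A x)) + l • A x = x := by
  let S : H →L[ℝ] H := i ∘L i.adjoint + l • ContinuousLinearMap.id ℝ H
  let B : H →L[ℝ] H →L[ℝ] ℝ := (innerSL ℝ) ∘L S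
  have hB : IsCoercive B := by
    refine ⟨l, hl, fun u => ?_⟩
    have : B u u = ‖i.adjoint u‖ ^ 2 + l * ‖u‖ ^ 2 := by
      change inner ℝ (i (i.adjoint u) + l • u) u = _
      rw [inner_add_left, real_inner_smul_left, real_inner_self_eq_norm_sq,
        ← ContinuousLinearMap.adjoint_inner_right, real_inner_self_eq_norm_sq]
    rw [this]
    nlinarith [sq_nonneg ‖i.adjoint u‖]
  refine ⟨(hB.continuousLinearEquivOfBilin.symm : H →L[ℝ] H), fun x => ?_⟩
  refine ext_inner_right ℝ fun w => ?_
  have := hB.continuousLinearEquivOfBilin_apply (hB.continuousLinearEquivOfBilin.symm x) w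
  rw [ContinuousLinearEquiv.apply_symm_apply] at this
  exact this.symm

/-- The regularized problem `u' = -v`, `(i i* + l) v = B(u) - i f`, together with its energy
inequality: test the equation with `B(u)` and use `2 (f, i* v) ≥ -|f|² - |i* v|²`. -/
theorem exists_regularized_solution (i : V →L[ℝ] H) {G : H → H → Prop} (hG : IsMonotoneGraph G)
    {l : ℝ} {B : H → H} {E : H → ℝ} (h : IsYosida G l B E) {f : ℝ → V} (hf : Continuous f)
    (T : ℝ) (u₀ : H) :
    ∃ u v : ℝ → H, Continuous u ∧ Continuous v ∧ (∀ t, u t = u₀ - ∫ s in (0 : ℝ)..t, v s) ∧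
      (∀ t ∈ Icc 0 T, B (u t) = i (i.adjoint (v t)) + l • v t + i (f t)) ∧
      ∀ t ∈ Icc 0 T, (∫ s in (0 : ℝ)..t, ‖i.adjoint (v s)‖ ^ 2)
        + 2 * l * (∫ s in (0 : ℝ)..t, ‖v s‖ ^ 2) + 2 * E (u t)
        ≤ 2 * E u₀ + ∫ s in (0 : ℝ)..t, ‖f s‖ ^ 2 := by
  obtain ⟨A, hA⟩ := exists_inverse_adjoint_add_smul i h.pos
  have hB := h.lipschitzWith hG
  let F : ℝ → H → H := fun t x => -A (B x - i (f t))
  have hF : ∀ t, LipschitzWith (‖A‖₊ * Real.toNNReal l⁻¹) (F t) := by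
    intro t
    refine LipschitzWith.of_dist_le_mul fun x y => ?_
    have e : F t x - F t y = -A (B x - B y) := by
      simp only [F, map_sub]; abel
    rw [dist_eq_norm, e, norm_neg, NNReal.coe_mul, mul_assoc]
    refine (A.le_opNorm _).trans ?_
    have := hB.dist_le_mul x y
    rw [dist_eq_norm] at this
    exact mul_le_mul_of_nonneg_left this (norm_nonneg _)
  have hFc : Continuous (Function.uncurry F) := by
    have := hB.continuous
    simp only [F, Function.uncurry_def]
    fun_prop
  obtain ⟨u, u', hu'c, hu0, hu, hu'⟩ := exists_global_solution hF hFc T u₀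
  have huc : Continuous u := continuous_iff_continuousAt.2 fun t => (hu t).continuousAt
  let v : ℝ → H := fun t => -u' t
  have hv : Continuous v := hu'c.neg
  have hvB : ∀ t ∈ Icc 0 T, B (u t) = i (i.adjoint (v t)) + l • v t + i (f t) := by
    intro t ht
    have : v t = A (B (u t) - i (f t)) := by simp [v, hu' t ht, F]
    rw [this, hA]
    abel
  refine ⟨u, v, huc, hv, fun t => ?_, hvB, fun t ht => ?_⟩
  · have := intervalIntegral.integral_eq_sub_of_hasDerivAt (fun s _ => hu s)
      (hu'c.intervalIntegrable 0 t)
    simp only [v, intervalIntegral.integral_neg, this, hu0]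
    abel
  · have hE : ∀ s, HasDerivAt (fun s => E (u s)) (inner ℝ (B (u s)) (u' s)) s := fun s =>
      (h.hasFDerivAt (u s)).comp_hasDerivAt s (hu s)
    have hBc := hB.continuous
    have hint : ∫ s in (0 : ℝ)..t, inner ℝ (B (u s)) (u' s) = E (u t) - E u₀ := by
      rw [← hu0]
      exact intervalIntegral.integral_eq_sub_of_hasDerivAt (fun s _ => hE s)
        (Continuous.intervalIntegrable (by fun_prop) 0 t)
    have hpt : ∀ s ∈ Icc 0 t, ‖i.adjoint (v s)‖ ^ 2 + 2 * l * ‖v s‖ ^ 2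
        + 2 * inner ℝ (B (u s)) (u' s) ≤ ‖f s‖ ^ 2 := by
      intro s hs
      have e : u' s = -v s := by simp [v]
      have h1 : inner ℝ (i (i.adjoint (v s))) (v s) = ‖i.adjoint (v s)‖ ^ 2 := by
        rw [← ContinuousLinearMap.adjoint_inner_right, real_inner_self_eq_norm_sq]
      have h2 : inner ℝ (i (f s)) (v s) = inner ℝ (f s) (i.adjoint (v s)) := by
        rw [← ContinuousLinearMap.adjoint_inner_right]
      have h3 := norm_add_sq_real (f s) (i.adjoint (v s))
      have h4 := sq_nonneg ‖f s + i.adjoint (v s)‖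
      rw [e, hvB s ⟨hs.1, hs.2.trans ht.2⟩, inner_neg_right, inner_add_left, inner_add_left,
        real_inner_smul_left, h1, h2, real_inner_self_eq_norm_sq]
      linarith
    have i1 : IntervalIntegrable (fun s => ‖i.adjoint (v s)‖ ^ 2) volume 0 t :=
      Continuous.intervalIntegrable (by fun_prop) 0 t
    have i2 : IntervalIntegrable (fun s => 2 * l * ‖v s‖ ^ 2) volume 0 t :=
      Continuous.intervalIntegrable (by fun_prop) 0 t
    have i3 : IntervalIntegrable (fun s => 2 * inner ℝ (B (u s)) (u' s)) volume 0 t :=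
      Continuous.intervalIntegrable (by fun_prop) 0 t
    have i4 : IntervalIntegrable (fun s => ‖f s‖ ^ 2) volume 0 t :=
      Continuous.intervalIntegrable (by fun_prop) 0 t
    have hmono := intervalIntegral.integral_mono_on ht.1 ((i1.add i2).add i3) i4 hpt
    rw [intervalIntegral.integral_add (i1.add i2) i3, intervalIntegral.integral_add i1 i2,
      intervalIntegral.integral_const_mul, intervalIntegral.integral_const_mul, hint] at hmono
    linarith

end Abstract

/-! ### Passage to the limit -/

theorem intervalIntegral_eq_setIntegral_Iio {F : Type*} [NormedAddCommGroup F] [NormedSpace ℝ F]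
    {T t : ℝ} (ht : t ∈ Icc 0 T) (g : ℝ → F) :
    ∫ s in (0 : ℝ)..t, g s = ∫ s in Iio t, g s ∂timeMeasure T := by
  rw [intervalIntegral.integral_of_le ht.1, integral_Ioc_eq_integral_Ioo,
    Measure.restrict_restrict measurableSet_Iio]
  congr 2
  ext s
  exact ⟨fun h => ⟨h.2, h.1, h.2.trans_le ht.2⟩, fun h => ⟨h.2.1, h.1⟩⟩

theorem intervalIntegral_eq_integral_timeMeasure {F : Type*} [NormedAddCommGroup F]
    [NormedSpace ℝ F] {T : ℝ} (hT : 0 ≤ T) (g : ℝ → F) :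
    ∫ s in (0 : ℝ)..T, g s = ∫ s, g s ∂timeMeasure T := by
  rw [intervalIntegral.integral_of_le hT, integral_Ioc_eq_integral_Ioo]

theorem integral_norm_sq_eq {α F : Type*} [MeasurableSpace α] {ν : Measure α}
    [NormedAddCommGroup F] [InnerProductSpace ℝ F] (g : Lp F 2 ν) :
    ∫ s, ‖g s‖ ^ 2 ∂ν = ‖g‖ ^ 2 := by
  rw [← real_inner_self_eq_norm_sq g, L2.inner_def]
  simp only [real_inner_self_eq_norm_sq]

theorem memLp_timeMeasure_of_continuous {F : Type*} [NormedAddCommGroup F]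
    {g : ℝ → F} (hg : Continuous g) (T : ℝ) (p : ℝ≥0∞) : MemLp g p (timeMeasure T) := by
  obtain ⟨C, hC⟩ := (isCompact_Icc (a := (0 : ℝ)) (b := T)).exists_bound_of_continuousOn
    hg.continuousOn
  refine MemLp.of_bound hg.aestronglyMeasurable C ?_
  filter_upwards [ae_restrict_mem measurableSet_Ioo] with t ht
  exact hC t ⟨ht.1.le, ht.2.le⟩

theorem exists_continuous_approximation {V : Type*} [NormedAddCommGroup V] [NormedSpace ℝ V]
    {T : ℝ} (f : Lp V 2 (timeMeasure T)) :
    ∃ φ : ℕ → ℝ → V, ∃ hφ : ∀ n, Continuous (φ n),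
      Tendsto (fun n => (memLp_timeMeasure_of_continuous (hφ n) T 2).toLp) atTop (𝓝 f) := by
  have h : ∀ n : ℕ, ∃ g : ℝ → V, Continuous g ∧
      eLpNorm (⇑f - g) 2 (timeMeasure T) ≤ ENNReal.ofReal (1 / (n + 1 : ℝ)) := by
    intro n
    obtain ⟨g, hg, -⟩ := (Lp.memLp f).exists_boundedContinuous_eLpNorm_sub_le (by norm_num)
      (ε := ENNReal.ofReal (1 / (n + 1 : ℝ))) (by
        simpa using (by positivity : (0 : ℝ) < n + 1))
    exact ⟨g, g.continuous, hg⟩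
  choose φ hφ hn using h
  refine ⟨φ, hφ, tendsto_iff_dist_tendsto_zero.2 ?_⟩
  refine squeeze_zero (fun _ => dist_nonneg) (fun n => ?_) tendsto_one_div_add_atTop_nhds_zero_nat
  rw [dist_comm, Lp.dist_def]
  refine ENNReal.toReal_le_of_le_ofReal (by positivity) ?_
  refine (le_of_eq (eLpNorm_congr_ae ?_)).trans (hn n)
  filter_upwards [(memLp_timeMeasure_of_continuous (hφ n) T 2).coeFn_toLp] with t ht
  simp [ht]

section Limit

variable {H V : Type*} [NormedAddCommGroup H] [InnerProductSpace ℝ H]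
  [NormedAddCommGroup V] [InnerProductSpace ℝ V]

/-- Minty's argument: a maximal monotone graph is closed under weak limits `uₙ ⇀ u`, `wₙ ⇀ w` in
`L²`, provided that `limsup (uₙ, wₙ) ≤ (u, w)`. Maximality enters through the resolvent
`R = (1 + G)⁻¹`, evaluated at `u + w`. -/
theorem graph_of_weak_limit {α : Type*} [MeasurableSpace α] {ν : Measure α} {G : H → H → Prop}
    (hG : IsMonotoneGraph G) {R : H → H} (hR : ∀ x, G (R x) (x - R x)) (hR0 : R 0 = 0)
    {𝓕 : Filter ℕ} [𝓕.NeBot] {l : ℕ → ℝ} (hl : Tendsto l 𝓕 (𝓝 0)) (hl0 : ∀ n, 0 ≤ l n)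
    {un wn : ℕ → Lp H 2 ν} {u w : Lp H 2 ν}
    (hgr : ∀ n, ∀ᵐ t ∂ν, G (un n t - l n • wn n t) (wn n t))
    (hu : ∀ z, Tendsto (fun n => inner ℝ (un n) z) 𝓕 (𝓝 (inner ℝ u z)))
    (hw : ∀ z, Tendsto (fun n => inner ℝ (wn n) z) 𝓕 (𝓝 (inner ℝ w z)))
    {a : ℕ → ℝ} (ha : Tendsto a 𝓕 (𝓝 (inner ℝ u w))) (hle : ∀ n, inner ℝ (un n) (wn n) ≤ a n) :
    ∀ᵐ t ∂ν, G (u t) (w t) := by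
  have hLip := hG.lipschitzWith_resolvent hR
  set r : Lp H 2 ν := hLip.compLp hR0 (u + w) with hr
  have hrt : ∀ᵐ t ∂ν, r t = R (u t + w t) := by
    filter_upwards [hLip.coeFn_compLp hR0 (u + w), Lp.coeFn_add u w] with t h1 h2
    rw [hr, h1, Function.comp_apply, h2, Pi.add_apply]
  set s : Lp H 2 ν := u + w - r with hs
  have hst : ∀ᵐ t ∂ν, s t = u t + w t - r t := by
    filter_upwards [Lp.coeFn_sub (u + w) r, Lp.coeFn_add u w] with t h1 h2
    rw [hs, h1, Pi.sub_apply, h2, Pi.add_apply]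
  have hmon : ∀ n, 0 ≤ inner ℝ (un n - l n • wn n - r) (wn n - s) := by
    intro n
    rw [L2.inner_def]
    refine integral_nonneg_of_ae ?_
    filter_upwards [hgr n, hrt, hst, Lp.coeFn_sub (un n - l n • wn n) r,
      Lp.coeFn_sub (un n) (l n • wn n), Lp.coeFn_smul (l n) (wn n), Lp.coeFn_sub (wn n) s]
      with t h1 h2 h3 h4 h5 h6 h7
    rw [h4, h7, Pi.sub_apply, Pi.sub_apply, h5, Pi.sub_apply, h6, Pi.smul_apply, h3, h2]
    exact hG h1 (hR _)
  have hn : ∀ n, 0 ≤ a n - inner ℝ (un n) s - inner ℝ (wn n) r + l n * inner ℝ (wn n) s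
      + inner ℝ r s := by
    intro n
    have h1 := hmon n
    simp only [inner_sub_left, inner_sub_right, real_inner_smul_left,
      real_inner_self_eq_norm_sq] at h1
    have h2 := mul_nonneg (hl0 n) (sq_nonneg ‖wn n‖)
    have h3 := hle n
    rw [real_inner_comm (wn n) r] at h1
    linarith
  have hlim := (((ha.sub (hu s)).sub (hw r)).add (hl.mul (hw s))).add
    (tendsto_const_nhds (x := inner ℝ r s))
  have h0 := ge_of_tendsto' hlim hn
  have h1 : inner ℝ u w - inner ℝ u s - inner ℝ w r + 0 * inner ℝ w s + inner ℝ r s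
      = - ‖u - r‖ ^ 2 := by
    rw [← real_inner_self_eq_norm_sq, hs]
    simp only [inner_sub_left, inner_sub_right, inner_add_right]
    rw [real_inner_comm r u, real_inner_comm w r]
    ring
  have hur : u = r := by
    have : ‖u - r‖ ^ 2 ≤ 0 := by linarith
    rw [← sub_eq_zero, ← norm_eq_zero]
    exact pow_eq_zero_iff (two_ne_zero) |>.1 (le_antisymm this (sq_nonneg _))
  have hurt : ∀ᵐ t ∂ν, u t = r t := by rw [← hur]; exact Eventually.of_forall fun _ => rfl
  filter_upwards [hrt, hurt] with t h1 h2
  have h3 := hR (u t + w t)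
  rw [← h1, ← h2] at h3
  simpa using h3

variable [CompleteSpace H] [CompleteSpace V]

/-- The primitive of an `L²` function, as a pairing with the primitive of the test function: the
relation "`y` is a primitive" is preserved by weak limits. -/
theorem inner_primitive {ν : Measure ℝ} [IsFiniteMeasure ν] (g m : Lp V 2 ν) :
    ∫ t, inner ℝ (g t) (∫ s in Iio t, m s ∂ν) ∂ν
      = inner ℝ m (memLp_primitive_Ioi ((Lp.memLp g).integrable (by norm_num)) 2).toLp := by
  have h1 : ∫ t, inner ℝ (g t) (∫ s in Iio t, m s ∂ν) ∂ν
      = ∫ s, inner ℝ (∫ t in Ioi s, g t ∂ν) (m s) ∂ν :=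
    integral_bilin_primitive (innerSL ℝ) ((Lp.memLp g).integrable (by norm_num))
      ((Lp.memLp m).integrable (by norm_num))
  rw [h1, L2.inner_def]
  refine integral_congr_ae ?_
  filter_upwards [(memLp_primitive_Ioi ((Lp.memLp g).integrable (by norm_num)) 2).coeFn_toLp]
    with t ht
  rw [ht, real_inner_comm]

theorem primitive_of_weak_limit {ν : Measure ℝ} [IsFiniteMeasure ν] (i : V →L[ℝ] H)
    {𝓕 : Filter ℕ} [𝓕.NeBot] {un : ℕ → Lp H 2 ν} {u : Lp H 2 ν} {mn : ℕ → Lp V 2 ν}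
    {m : Lp V 2 ν} (y₀ : V)
    (hu : ∀ z, Tendsto (fun n => inner ℝ (un n) z) 𝓕 (𝓝 (inner ℝ u z)))
    (hm : ∀ z, Tendsto (fun n => inner ℝ (mn n) z) 𝓕 (𝓝 (inner ℝ m z)))
    (h : ∀ n, ∀ᵐ t ∂ν, i.adjoint (un n t) = y₀ - ∫ s in Iio t, mn n s ∂ν) :
    ∀ᵐ t ∂ν, i.adjoint (u t) = y₀ - ∫ s in Iio t, m s ∂ν := by
  have hY : MemLp (fun t => y₀ - ∫ s in Iio t, m s ∂ν) 2 ν :=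
    (memLp_const y₀).sub (memLp_primitive_Iio ((Lp.memLp m).integrable (by norm_num)) 2)
  have hadj : ∀ (g : Lp V 2 ν) (v : Lp H 2 ν),
      inner ℝ v (i.compLp g) = ∫ t, inner ℝ (g t) (i.adjoint (v t)) ∂ν := by
    intro g v
    rw [L2.inner_def]
    refine integral_congr_ae ?_
    filter_upwards [i.coeFn_compLp g] with t ht
    rw [ht, ContinuousLinearMap.adjoint_inner_right, real_inner_comm]
  have hsplit : ∀ (g k : Lp V 2 ν), ∫ t, inner ℝ (g t) (y₀ - ∫ s in Iio t, k s ∂ν) ∂ν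
      = (∫ t, inner ℝ (g t) y₀ ∂ν)
        - inner ℝ k (memLp_primitive_Ioi ((Lp.memLp g).integrable (by norm_num)) 2).toLp := by
    intro g k
    rw [← inner_primitive]
    simp only [inner_sub_right]
    exact integral_sub (integrable_inner_of_memLp (Lp.memLp g) (memLp_const y₀))
      (integrable_inner_of_memLp (Lp.memLp g)
        (memLp_primitive_Iio ((Lp.memLp k).integrable (by norm_num)) 2))
  have heq : i.adjoint.compLp u = hY.toLp := by
    refine ext_inner_left ℝ fun g => ?_
    have e1 : inner ℝ g (i.adjoint.compLp u) = inner ℝ u (i.compLp g) := by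
      rw [hadj, L2.inner_def]
      refine integral_congr_ae ?_
      filter_upwards [i.adjoint.coeFn_compLp u] with t ht
      rw [ht]
    have e2 : inner ℝ g hY.toLp = ∫ t, inner ℝ (g t) (y₀ - ∫ s in Iio t, m s ∂ν) ∂ν := by
      rw [L2.inner_def]
      refine integral_congr_ae ?_
      filter_upwards [hY.coeFn_toLp] with t ht
      rw [ht]
    rw [e1, e2, hsplit]
    refine tendsto_nhds_unique (hu (i.compLp g)) ?_
    have e3 : ∀ n, inner ℝ (un n) (i.compLp g) = (∫ t, inner ℝ (g t) y₀ ∂ν) - inner ℝ (mn n)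
        (memLp_primitive_Ioi ((Lp.memLp g).integrable (by norm_num)) 2).toLp := by
      intro n
      rw [hadj, ← hsplit]
      refine integral_congr_ae ?_
      filter_upwards [h n] with t ht
      rw [ht]
    simp only [e3]
    exact tendsto_const_nhds.sub (hm _)
  filter_upwards [i.adjoint.coeFn_compLp u, hY.coeFn_toLp] with t h1 h2
  rw [← h1, ← h2, heq]

end Limit

section Evolution

variable {H V : Type*} [NormedAddCommGroup H] [InnerProductSpace ℝ H]
  [NormedAddCommGroup V] [InnerProductSpace ℝ V]

/-- The energy identity for `i* u = y₀ - ∫ m`, integrated over the whole time interval. -/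
theorem inner_compLp_of_primitive [CompleteSpace H] [CompleteSpace V]
    {ν : Measure ℝ} [IsFiniteMeasure ν] [NullSingletonClass ν]
    (i : V →L[ℝ] H) (y₀ : V) {u : Lp H 2 ν} {m : Lp V 2 ν}
    (h : ∀ᵐ t ∂ν, i.adjoint (u t) = y₀ - ∫ s in Iio t, m s ∂ν) :
    inner ℝ u (i.compLp m) = inner ℝ y₀ (∫ s, m s ∂ν) - ‖∫ s, m s ∂ν‖ ^ 2 / 2 := by
  have hmi : Integrable m ν := (Lp.memLp m).integrable (by norm_num)
  rw [← integral_inner_primitive (Lp.memLp m), ← integral_inner hmi, L2.inner_def,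
    ← integral_sub (hmi.const_inner y₀)
      (integrable_inner_of_memLp (Lp.memLp m) (memLp_primitive_Iio hmi 2))]
  refine integral_congr_ae ?_
  filter_upwards [h, i.coeFn_compLp m] with t h1 h2
  rw [h2, ← ContinuousLinearMap.adjoint_inner_left, h1, inner_sub_left,
    real_inner_comm (m t) (∫ s in Iio t, m s ∂ν)]

theorem inner_toLp_indicator {ν : Measure ℝ} {s : Set ℝ} (hs : MeasurableSet s) (g m : Lp V 2 ν) :
    inner ℝ g ((Lp.memLp m).indicator hs).toLp = ∫ t in s, inner ℝ (g t) (m t) ∂ν := by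
  rw [L2.inner_def, ← integral_indicator hs]
  refine integral_congr_ae ?_
  filter_upwards [((Lp.memLp m).indicator hs).coeFn_toLp] with t ht
  rw [ht]
  by_cases h : t ∈ s <;> simp [h]

theorem norm_toLp_sq {T : ℝ} (hT : 0 ≤ T) {g : ℝ → V} (hg : Continuous g) :
    ‖(memLp_timeMeasure_of_continuous hg T 2).toLp‖ ^ 2 = ∫ s in (0 : ℝ)..T, ‖g s‖ ^ 2 := by
  rw [intervalIntegral_eq_integral_timeMeasure hT, ← integral_norm_sq_eq]
  refine integral_congr_ae ?_
  filter_upwards [(memLp_timeMeasure_of_continuous hg T 2).coeFn_toLp] with t ht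
  rw [ht]

/-- Solvability of `i* u(t) = i* u₀ - ∫₀ᵗ m`, `(u, i (m + f)) ∈ G`, with the energy estimate, for a
monotone graph `G` with everywhere defined resolvent whose Yosida approximations are gradients. The
estimate holds at every time, not only almost everywhere. -/
theorem exists_evolution [CompleteSpace H] [CompleteSpace V] (i : V →L[ℝ] H)
    (hi : ∀ h, i.adjoint h = 0 → h = 0) {G : H → H → Prop} (hG : IsMonotoneGraph G)
    {l c : ℕ → ℝ} {B : ℕ → H → H} {E : ℕ → H → ℝ}
    (hY : ∀ n, IsYosida G (l n) (B n) (E n)) (hl : Tendsto l atTop (𝓝 0))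
    {c₀ δ : ℝ} (hc : Tendsto c atTop (𝓝 c₀)) (hδ : 0 < δ) (hδc : ∀ n, δ ≤ c n)
    (hE : ∀ n x, c n * ‖x‖ ^ 2 ≤ E n x)
    {R : H → H} (hR : ∀ x, G (R x) (x - R x)) (hR0 : R 0 = 0)
    {T : ℝ} (hT : 0 < T) (f : Lp V 2 (timeMeasure T)) (u₀ : H) {e₀ : ℝ} (he : ∀ n, E n u₀ ≤ e₀) :
    ∃ (U : ℝ → H) (m : Lp V 2 (timeMeasure T)),
      AEStronglyMeasurable U (timeMeasure T) ∧
      (∀ t ∈ Icc 0 T, i.adjoint (U t) = i.adjoint u₀ - ∫ s in (0 : ℝ)..t, m s) ∧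
      (∀ t ∈ Icc 0 T, (∫ s in (0 : ℝ)..t, ‖m s‖ ^ 2) + 2 * c₀ * ‖U t‖ ^ 2 ≤ 2 * e₀ + ‖f‖ ^ 2) ∧
      ∀ᵐ t ∂timeMeasure T, G (U t) (i (m t + f t)) := by
  obtain ⟨φ, hφ, hφf⟩ := exists_continuous_approximation f
  have hsol := fun n => exists_regularized_solution i hG (hY n) (hφ n) T u₀
  choose u v huc hvc hprim hB hen using hsol
  set fn : ℕ → Lp V 2 (timeMeasure T) := fun n =>
    (memLp_timeMeasure_of_continuous (hφ n) T 2).toLp with hfn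
  let un : ℕ → Lp H 2 (timeMeasure T) := fun n => (memLp_timeMeasure_of_continuous (huc n) T 2).toLp
  let vn : ℕ → Lp H 2 (timeMeasure T) := fun n => (memLp_timeMeasure_of_continuous (hvc n) T 2).toLp
  have hmc : ∀ n, Continuous fun t => i.adjoint (v n t) := fun n =>
    i.adjoint.continuous.comp (hvc n)
  let mn : ℕ → Lp V 2 (timeMeasure T) := fun n => (memLp_timeMeasure_of_continuous (hmc n) T 2).toLp
  have hun_ae : ∀ n, ∀ᵐ t ∂timeMeasure T, un n t = u n t := fun n => MemLp.coeFn_toLp _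
  have hvn_ae : ∀ n, ∀ᵐ t ∂timeMeasure T, vn n t = v n t := fun n => MemLp.coeFn_toLp _
  have hmn_ae : ∀ n, ∀ᵐ t ∂timeMeasure T, mn n t = i.adjoint (v n t) := fun n => MemLp.coeFn_toLp _
  have hfn_ae : ∀ n, ∀ᵐ t ∂timeMeasure T, fn n t = φ n t := fun n => MemLp.coeFn_toLp _
  have hmem : ∀ᵐ t ∂timeMeasure T, t ∈ Ioo 0 T := ae_restrict_mem measurableSet_Ioo
  -- Uniform bounds from the energy inequality.
  have hen' : ∀ n, ∀ t ∈ Icc 0 T, (∫ s in (0 : ℝ)..t, ‖i.adjoint (v n s)‖ ^ 2)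
      + 2 * l n * (∫ s in (0 : ℝ)..t, ‖v n s‖ ^ 2) + 2 * c n * ‖u n t‖ ^ 2
      ≤ 2 * e₀ + ‖fn n‖ ^ 2 := by
    intro n t ht
    have h1 := hen n t ht
    have h2 : ∫ s in (0 : ℝ)..t, ‖φ n s‖ ^ 2 ≤ ‖fn n‖ ^ 2 := by
      rw [hfn, norm_toLp_sq hT.le (hφ n)]
      exact intervalIntegral.integral_mono_interval le_rfl ht.1 ht.2
        (Eventually.of_forall fun _ => sq_nonneg _)
        (Continuous.intervalIntegrable (by have := hφ n; fun_prop) _ _)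
    have h3 := hE n (u n t)
    have h4 := he n
    linarith
  obtain ⟨Cf, hCf⟩ : ∃ Cf : ℝ, ∀ n, ‖fn n‖ ≤ Cf := by
    obtain ⟨C, hC⟩ := hφf.norm.bddAbove_range
    exact ⟨C, fun n => hC ⟨n, rfl⟩⟩
  set K : ℝ := 2 * e₀ + Cf ^ 2 with hK
  have hfK : ∀ n, 2 * e₀ + ‖fn n‖ ^ 2 ≤ K := fun n => by
    have := pow_le_pow_left₀ (norm_nonneg _) (hCf n) 2
    rw [hK]; linarith
  have hnonneg : ∀ (F : ℝ → ℝ) (t : ℝ), t ∈ Icc 0 T → 0 ≤ ∫ s in (0 : ℝ)..t, F s ^ 2 :=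
    fun F t ht => intervalIntegral.integral_nonneg ht.1 fun _ _ => sq_nonneg _
  have hub : ∀ n, ∀ t ∈ Icc 0 T, ‖u n t‖ ≤ Real.sqrt (K / (2 * δ)) := by
    intro n t ht
    refine Real.le_sqrt_of_sq_le ?_
    rw [le_div_iff₀ (by positivity)]
    have h1 := hen' n t ht
    have h2 := hnonneg (fun s => ‖i.adjoint (v n s)‖) t ht
    have h3 := mul_nonneg (hY n).pos.le (hnonneg (fun s => ‖v n s‖) t ht)
    have h4 := mul_le_mul_of_nonneg_right (hδc n) (sq_nonneg ‖u n t‖)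
    have h5 := hfK n
    linarith
  have hTI : T ∈ Icc 0 T := ⟨hT.le, le_rfl⟩
  have hbT : ∀ n, ‖mn n‖ ^ 2 + 2 * (l n * ‖vn n‖ ^ 2) ≤ K := by
    intro n
    have h1 := hen' n T hTI
    have e1 : ‖mn n‖ ^ 2 = _ := norm_toLp_sq hT.le (hmc n)
    have e2 : ‖vn n‖ ^ 2 = _ := norm_toLp_sq hT.le (hvc n)
    rw [e1, e2]
    have h4 := mul_nonneg (hδ.le.trans (hδc n)) (sq_nonneg ‖u n T‖)
    have h5 := hfK n
    linarith
  have hmb : ∀ n, ‖mn n‖ ≤ Real.sqrt K := fun n => by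
    refine Real.le_sqrt_of_sq_le ?_
    have := hbT n
    have := mul_nonneg (hY n).pos.le (sq_nonneg ‖vn n‖)
    linarith
  have hunb : ∃ C, ∀ n, ‖un n‖ ≤ C := by
    refine ⟨_, fun n => Lp.norm_le_of_ae_bound (Real.sqrt_nonneg (K / (2 * δ))) ?_⟩
    filter_upwards [hun_ae n, hmem] with t h1 h2
    rw [h1]
    exact hub n t ⟨h2.1.le, h2.2.le⟩
  obtain ⟨Cu, hCu⟩ := hunb
  -- `l |vn|² ≤ K / 2`, so `l vn` tends to zero strongly although `vn` need not be bounded.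
  have hlv : Tendsto (fun n => l n • vn n) atTop (𝓝 0) := by
    have h1 : Tendsto (fun n => Real.sqrt (l n * (K / 2))) atTop (𝓝 0) := by
      have := (Real.continuous_sqrt.tendsto _).comp (hl.mul_const (K / 2))
      simpa [Function.comp_def] using this
    refine squeeze_zero_norm (fun n => Real.le_sqrt_of_sq_le ?_) h1
    rw [norm_smul, Real.norm_of_nonneg (hY n).pos.le, mul_pow, sq, mul_assoc]
    refine mul_le_mul_of_nonneg_left ?_ (hY n).pos.le
    have := hbT n
    have := sq_nonneg ‖mn n‖
    linarith
  -- Weak limits along a fixed nonprincipal ultrafilter.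
  let 𝒰 : Ultrafilter ℕ := hyperfilter ℕ
  have h𝒰 : (𝒰 : Filter ℕ) ≤ atTop := Nat.hyperfilter_le_atTop
  obtain ⟨m, hm⟩ := exists_weak_limit 𝒰 hmb
  obtain ⟨ul, hul⟩ := exists_weak_limit 𝒰 hCu
  have hUex : ∀ t, ∃ y : H, t ∈ Icc 0 T →
      ∀ z, Tendsto (fun n => inner ℝ (u n t) z) 𝒰 (𝓝 (inner ℝ y z)) := by
    intro t
    by_cases ht : t ∈ Icc 0 T
    · obtain ⟨y, hy⟩ := exists_weak_limit 𝒰 (fun n => hub n t ht)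
      exact ⟨y, fun _ => hy⟩
    · exact ⟨0, fun h => absurd h ht⟩
  choose U hU using hUex
  have hset : ∀ (g : Lp V 2 (timeMeasure T)) (s : Set ℝ) (hs : MeasurableSet s) (z : V),
      inner ℝ (∫ r in s, g r ∂timeMeasure T) z
        = inner ℝ g (indicatorConstLp 2 hs (measure_ne_top (timeMeasure T) s) z) := by
    intro g s hs z
    rw [real_inner_comm, real_inner_comm _ g,
      L2.inner_indicatorConstLp_eq_inner_setIntegral ℝ hs (measure_ne_top (timeMeasure T) s) z g]
  have hsetlim : ∀ s : Set ℝ, MeasurableSet s → ∀ z : V,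
      Tendsto (fun n => inner ℝ (∫ r in s, mn n r ∂timeMeasure T) z) 𝒰
        (𝓝 (inner ℝ (∫ r in s, m r ∂timeMeasure T) z)) := by
    intro s hs z
    simp only [hset _ s hs]
    exact hm _
  have hprim_n : ∀ n, ∀ t ∈ Icc 0 T,
      i.adjoint (u n t) = i.adjoint u₀ - ∫ s in Iio t, mn n s ∂timeMeasure T := by
    intro n t ht
    rw [hprim n t, map_sub, ← ContinuousLinearMap.intervalIntegral_comp_comm _
      ((hvc n).intervalIntegrable _ _), intervalIntegral_eq_setIntegral_Iio ht]
    congr 1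
    refine integral_congr_ae (ae_restrict_of_ae ?_)
    filter_upwards [hmn_ae n] with s hs
    rw [hs]
  have hprimU : ∀ t ∈ Icc 0 T,
      i.adjoint (U t) = i.adjoint u₀ - ∫ s in Iio t, m s ∂timeMeasure T := by
    intro t ht
    refine ext_inner_right ℝ fun z => ?_
    rw [ContinuousLinearMap.adjoint_inner_left, inner_sub_left]
    refine tendsto_nhds_unique (hU t ht (i z)) ?_
    have e : ∀ n, inner ℝ (u n t) (i z)
        = inner ℝ (i.adjoint u₀) z - inner ℝ (∫ s in Iio t, mn n s ∂timeMeasure T) z := by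
      intro n
      rw [← ContinuousLinearMap.adjoint_inner_left, hprim_n n t ht, inner_sub_left]
    simp only [e]
    exact tendsto_const_nhds.sub (hsetlim _ measurableSet_Iio z)
  have hprim_ae : ∀ n, ∀ᵐ t ∂timeMeasure T,
      i.adjoint (un n t) = i.adjoint u₀ - ∫ s in Iio t, mn n s ∂timeMeasure T := by
    intro n
    filter_upwards [hun_ae n, hmem] with t h1 h2
    rw [h1, hprim_n n t ⟨h2.1.le, h2.2.le⟩]
  have hprim_ul := primitive_of_weak_limit i (i.adjoint u₀) hul hm hprim_ae
  have hulU : ∀ᵐ t ∂timeMeasure T, ul t = U t := by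
    filter_upwards [hprim_ul, hmem] with t h1 h2
    rw [← sub_eq_zero]
    refine hi _ ?_
    rw [map_sub, h1, hprimU t ⟨h2.1.le, h2.2.le⟩, sub_self]
  refine ⟨U, m, (Lp.aestronglyMeasurable ul).congr hulU, fun t ht => ?_, fun t ht => ?_, ?_⟩
  · rw [hprimU t ht, intervalIntegral_eq_setIntegral_Iio ht]
  · -- Weak lower semicontinuity, through `2 (x, y) - |y|² ≤ |x|²`.
    set k : Lp V 2 (timeMeasure T) :=
      ((Lp.memLp m).indicator (measurableSet_Iio (a := t))).toLp with hk
    have hkk : inner ℝ m k = ∫ s in (0 : ℝ)..t, ‖m s‖ ^ 2 := by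
      rw [hk, inner_toLp_indicator measurableSet_Iio, intervalIntegral_eq_setIntegral_Iio ht]
      simp only [real_inner_self_eq_norm_sq]
    have hi1 := fun n => integrable_inner_of_memLp (Lp.memLp (mn n)) (Lp.memLp m)
    have hi2 := integrable_inner_of_memLp (Lp.memLp m) (Lp.memLp m)
    have hn : ∀ n, 2 * inner ℝ (mn n) k - inner ℝ m k
        + 2 * c n * (2 * inner ℝ (u n t) (U t) - ‖U t‖ ^ 2) ≤ 2 * e₀ + ‖fn n‖ ^ 2 := by
      intro n
      have h1 : 2 * inner ℝ (mn n) k - inner ℝ m k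
          ≤ ∫ s in (0 : ℝ)..t, ‖i.adjoint (v n s)‖ ^ 2 := by
        rw [hk, inner_toLp_indicator measurableSet_Iio, inner_toLp_indicator measurableSet_Iio,
          ← integral_const_mul,
          ← integral_sub ((hi1 n).restrict.const_mul 2) hi2.restrict,
          intervalIntegral_eq_setIntegral_Iio ht]
        refine integral_mono_ae ?_ ?_ (ae_restrict_of_ae ?_)
        · exact ((hi1 n).restrict.const_mul 2).sub hi2.restrict
        · exact ((memLp_timeMeasure_of_continuous (hmc n) T 2).integrable_norm_pow
            two_ne_zero).restrict
        · filter_upwards [hmn_ae n] with s hs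
          simp only [hs, real_inner_self_eq_norm_sq]
          have := norm_sub_sq_real (i.adjoint (v n s)) (m s)
          have := sq_nonneg ‖i.adjoint (v n s) - m s‖
          linarith
      have h2 : 2 * inner ℝ (u n t) (U t) - ‖U t‖ ^ 2 ≤ ‖u n t‖ ^ 2 := by
        have := norm_sub_sq_real (u n t) (U t)
        have := sq_nonneg ‖u n t - U t‖
        linarith
      have h3 := mul_le_mul_of_nonneg_left h2 (hδ.le.trans (hδc n))
      have h4 := mul_nonneg (hY n).pos.le (hnonneg (fun s => ‖v n s‖) t ht)
      have h5 := hen' n t ht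
      linarith
    have hL := (((hm k).const_mul 2).sub_const (inner ℝ m k)).add
      (((hc.mono_left h𝒰).const_mul 2).mul (((hU t ht (U t)).const_mul 2).sub_const (‖U t‖ ^ 2)))
    have hRt := ((hφf.mono_left h𝒰).norm.pow 2).const_add (2 * e₀)
    have := le_of_tendsto_of_tendsto' hL hRt hn
    rw [hkk, real_inner_self_eq_norm_sq] at this
    linarith
  · -- `wn = B(un)` differs from `i (mn + f)` by the strongly null sequence `q`.
    let iL : Lp V 2 (timeMeasure T) →L[ℝ] Lp H 2 (timeMeasure T) := i.compLpL 2 (timeMeasure T)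
    let q : ℕ → Lp H 2 (timeMeasure T) := fun n => l n • vn n + iL (fn n - f)
    have hq : Tendsto q 𝒰 (𝓝 0) := by
      have h1 : Tendsto (fun n => fn n - f) atTop (𝓝 0) := by
        simpa using hφf.sub_const f
      have h2 := hlv.add ((iL.continuous.tendsto 0).comp h1)
      simp only [map_zero, add_zero] at h2
      exact h2.mono_left h𝒰
    let wn : ℕ → Lp H 2 (timeMeasure T) := fun n => iL (mn n) + iL f + q n
    have hwn_ae : ∀ n, ∀ᵐ t ∂timeMeasure T, wn n t = B n (u n t) := by
      intro n
      have e : wn n = iL (mn n) + l n • vn n + iL (fn n) := by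
        simp only [wn, q, map_sub]; abel
      rw [e]
      filter_upwards [Lp.coeFn_add (iL (mn n) + l n • vn n) (iL (fn n)),
        Lp.coeFn_add (iL (mn n)) (l n • vn n), Lp.coeFn_smul (l n) (vn n),
        i.coeFn_compLpL (mn n), i.coeFn_compLpL (fn n), hmn_ae n, hvn_ae n, hfn_ae n, hmem]
        with t h1 h2 h3 h4 h5 h6 h7 h8 h9
      rw [h1, Pi.add_apply, h2, Pi.add_apply, h3, Pi.smul_apply, h4, h5, h6, h7, h8,
        hB n t ⟨h9.1.le, h9.2.le⟩]
    have hgr : ∀ n, ∀ᵐ t ∂timeMeasure T, G (un n t - l n • wn n t) (wn n t) := by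
      intro n
      filter_upwards [hwn_ae n, hun_ae n] with t h1 h2
      rw [h1, h2]
      exact (hY n).mem _
    have hw : ∀ z, Tendsto (fun n => inner ℝ (wn n) z) 𝒰 (𝓝 (inner ℝ (iL (m + f)) z)) := by
      intro z
      have h1 : Tendsto (fun n => inner ℝ (q n) z) 𝒰 (𝓝 0) := by
        have := (tendsto_inner_zero (x := fun _ => z) (fun _ => le_rfl) hq)
        simpa only [real_inner_comm] using this
      have h2 := ((hm (iL.adjoint z)).add_const (inner ℝ (iL f) z)).add h1
      simpa only [wn, map_add, inner_add_left, ContinuousLinearMap.adjoint_inner_right,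
        add_zero] using h2
    let M : V := ∫ s, m s ∂timeMeasure T
    let Mn : ℕ → V := fun n => ∫ s, mn n s ∂timeMeasure T
    have hMn : ∀ z, Tendsto (fun n => inner ℝ (Mn n) z) 𝒰 (𝓝 (inner ℝ M z)) := by
      intro z
      have := hsetlim univ MeasurableSet.univ z
      simpa only [setIntegral_univ] using this
    let a : ℕ → ℝ := fun n => inner ℝ (Mn n) (i.adjoint u₀) - inner ℝ (Mn n) M + ‖M‖ ^ 2 / 2
      + inner ℝ (un n) (iL f) + inner ℝ (un n) (q n)
    have ha : Tendsto a 𝒰 (𝓝 (inner ℝ ul (iL (m + f)))) := by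
      have h1 := ((((hMn (i.adjoint u₀)).sub (hMn M)).add_const (‖M‖ ^ 2 / 2)).add
        (hul (iL f))).add (tendsto_inner_zero hCu hq)
      have e : inner ℝ M (i.adjoint u₀) - inner ℝ M M + ‖M‖ ^ 2 / 2 + inner ℝ ul (iL f) + 0
          = inner ℝ ul (iL (m + f)) := by
        have h2 : inner ℝ ul (iL m) = inner ℝ (i.adjoint u₀) M - ‖M‖ ^ 2 / 2 :=
          inner_compLp_of_primitive i (i.adjoint u₀) hprim_ul
        rw [map_add, inner_add_right, h2, real_inner_self_eq_norm_sq, real_inner_comm M]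
        ring
      rw [e] at h1
      exact h1
    have hle : ∀ n, inner ℝ (un n) (wn n) ≤ a n := by
      intro n
      have h2 : inner ℝ (un n) (iL (mn n)) = inner ℝ (i.adjoint u₀) (Mn n) - ‖Mn n‖ ^ 2 / 2 :=
        inner_compLp_of_primitive i (i.adjoint u₀) (hprim_ae n)
      have h3 := norm_sub_sq_real (Mn n) M
      have h4 := sq_nonneg ‖Mn n - M‖
      simp only [wn, a, inner_add_right, h2]
      rw [real_inner_comm (Mn n) (i.adjoint u₀)]
      linarith
    have hfin := graph_of_weak_limit hG hR hR0 (hl.mono_left h𝒰) (fun n => (hY n).pos.le) hgr hul hw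
      ha hle
    filter_upwards [hfin, hulU, i.coeFn_compLpL (m + f), Lp.coeFn_add m f] with t h1 h2 h3 h4
    rw [← h2]
    have h5 : iL (m + f) t = i (m t + f t) := by
      rw [show iL (m + f) t = i ((m + f) t) from h3, h4, Pi.add_apply]
    rw [← h5]
    exact h1

end Evolution

/-! ### Uniqueness -/

/-- Monotonicity forces the difference of two evolutions with the same initial value to vanish: the
squared norm of the primitive of `m` has nonpositive derivative. -/
theorem eq_zero_of_monotone {H V : Type*} [NormedAddCommGroup H] [InnerProductSpace ℝ H]
    [NormedAddCommGroup V] [InnerProductSpace ℝ V] [CompleteSpace H] [CompleteSpace V]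
    {ν : Measure ℝ} [IsFiniteMeasure ν] [NullSingletonClass ν]
    (i : V →L[ℝ] H) (hi : ∀ h, i.adjoint h = 0 → h = 0) {w : ℝ → H} {m : ℝ → V} (hm : MemLp m 2 ν)
    (h : ∀ᵐ t ∂ν, i.adjoint (w t) = -∫ s in Iio t, m s ∂ν)
    (hmon : ∀ᵐ t ∂ν, 0 ≤ inner ℝ (w t) (i (m t))) : ∀ᵐ t ∂ν, w t = 0 := by
  have key : ∀ τ, ∫ s in Iio τ, m s ∂ν = 0 := by
    intro τ
    have h1 := integral_inner_primitive (hm.restrict (Iio τ))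
    have h2 : ∫ t in Iio τ, inner ℝ (m t) (∫ s in Iio t, m s ∂ν.restrict (Iio τ)) ∂ν ≤ 0 := by
      refine integral_nonpos_of_ae ?_
      filter_upwards [ae_restrict_of_ae h, ae_restrict_of_ae hmon,
        ae_restrict_mem measurableSet_Iio] with t h3 h4 h5
      rw [Measure.restrict_restrict measurableSet_Iio,
        inter_eq_left.2 (Iio_subset_Iio (le_of_lt h5)), ← neg_eq_iff_eq_neg.2 h3, inner_neg_right,
        ContinuousLinearMap.adjoint_inner_right, real_inner_comm]
      simpa using h4
    rw [h1] at h2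
    have h3 := sq_nonneg ‖∫ s in Iio τ, m s ∂ν‖
    rw [← norm_eq_zero]
    exact pow_eq_zero_iff (two_ne_zero) |>.1 (by linarith)
  filter_upwards [h] with t ht
  exact hi _ (by rw [ht, key, neg_zero])

/-! ### Weak derivatives in time -/

section WeakDerivative

theorem exists_Icc_of_isCompact {K : Set ℝ} (hK : IsCompact K) {T : ℝ} (hT : 0 < T)
    (h : K ⊆ Ioo 0 T) : ∃ a b, 0 < a ∧ b < T ∧ K ⊆ Icc a b := by
  rcases K.eq_empty_or_nonempty with rfl | hne
  · exact ⟨T, 0, hT, hT, empty_subset _⟩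
  · obtain ⟨a, ha, ha'⟩ := hK.exists_isLeast hne
    obtain ⟨b, hb, hb'⟩ := hK.exists_isGreatest hne
    exact ⟨a, b, (h ha).1, (h hb).2, fun x hx => ⟨ha' hx, hb' hx⟩⟩

theorem IsTestFunction.eq_zero {T : ℝ} {φ : ℝ → ℝ} (h : IsTestFunction (Ioo 0 T) φ) {t : ℝ}
    (ht : t ∉ Ioo 0 T) : φ t = 0 :=
  image_eq_zero_of_notMem_tsupport fun hx => ht (h.2.2 hx)

theorem IsTestFunction.continuous_deriv {T : ℝ} {φ : ℝ → ℝ} (h : IsTestFunction (Ioo 0 T) φ) :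
    Continuous (deriv φ) := h.1.continuous_deriv (by simp)

theorem IsTestFunction.integral_deriv_Ioi {T : ℝ} {φ : ℝ → ℝ} (h : IsTestFunction (Ioo 0 T) φ)
    {s : ℝ} (hs : s ∈ Ico 0 T) : ∫ t in Ioi s, deriv φ t ∂timeMeasure T = -φ s := by
  have h1 : ∫ t in Ioi s, deriv φ t ∂timeMeasure T = ∫ t in s..T, deriv φ t := by
    rw [intervalIntegral.integral_of_le hs.2.le, integral_Ioc_eq_integral_Ioo,
      Measure.restrict_restrict measurableSet_Ioi]
    congr 2
    ext t
    exact ⟨fun h => ⟨h.1, h.2.2⟩, fun h => ⟨h.1, hs.1.trans_lt h.1, h.2⟩⟩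
  rw [h1, intervalIntegral.integral_deriv_eq_sub
    (fun t _ => (h.1.differentiable (by simp)).differentiableAt)
    (h.continuous_deriv.intervalIntegrable _ _), h.eq_zero (t := T) (by simp), zero_sub]

variable {X : Type*} [NormedAddCommGroup X] [NormedSpace ℝ X] {T : ℝ}

theorem integrable_test_smul {θ : ℝ → ℝ} (hθ : Continuous θ) {z : ℝ → X}
    (hz : Integrable z (timeMeasure T)) : Integrable (fun t => θ t • z t) (timeMeasure T) := by
  have : MemLp (fun t => θ t • z t) 1 (timeMeasure T) :=
    (memLp_one_iff_integrable.2 hz).smul (memLp_timeMeasure_of_continuous hθ T ⊤)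
  exact memLp_one_iff_integrable.1 this

variable [CompleteSpace X]

theorem IsTestFunction.integral_deriv_smul_const {φ : ℝ → ℝ} (h : IsTestFunction (Ioo 0 T) φ)
    (hT : 0 < T) (c : X) : ∫ t in Ioo 0 T, deriv φ t • c = 0 := by
  rw [integral_smul_const]
  have h1 := h.integral_deriv_Ioi (s := 0) ⟨le_rfl, hT⟩
  rw [Measure.restrict_restrict measurableSet_Ioi, h.eq_zero (t := 0) (by simp),
    inter_eq_right.2 Ioo_subset_Ioi_self, neg_zero] at h1
  rw [h1, zero_smul]

/-- The primitive of an integrable function has that function as weak derivative. -/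
theorem hasWeakTimeDeriv_primitive {y : ℝ → X} (hy : Integrable y (timeMeasure T)) :
    HasWeakTimeDeriv T (fun t => ∫ s in Iio t, y s ∂timeMeasure T) y := by
  intro φ hφ
  have h1 : ∫ t in Ioo 0 T, deriv φ t • (∫ s in Iio t, y s ∂timeMeasure T)
      = ∫ s in Ioo 0 T, (∫ t in Ioi s, deriv φ t ∂timeMeasure T) • y s :=
    integral_bilin_primitive (ν := timeMeasure T) (ContinuousLinearMap.lsmul ℝ ℝ)
      ((memLp_timeMeasure_of_continuous hφ.continuous_deriv T 1).integrable le_rfl) hy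
  rw [h1, ← integral_neg]
  refine integral_congr_ae ?_
  filter_upwards [ae_restrict_mem measurableSet_Ioo] with s hs
  rw [hφ.integral_deriv_Ioi ⟨hs.1.le, hs.2⟩, neg_smul]

/-- A test function on `(0, T)` with integral `0` is the derivative of a test function. -/
theorem IsTestFunction.exists_primitive {θ : ℝ → ℝ} (hT : 0 < T) (h : IsTestFunction (Ioo 0 T) θ)
    (h0 : ∫ t in Ioo 0 T, θ t = 0) : ∃ φ, IsTestFunction (Ioo 0 T) φ ∧ deriv φ = θ := by
  obtain ⟨a, b, ha, hb, hK⟩ := exists_Icc_of_isCompact h.2.1 hT h.2.2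
  have hzero : ∀ t, t ∉ Icc a b → θ t = 0 := fun t ht =>
    image_eq_zero_of_notMem_tsupport fun hx => ht (hK hx)
  have hc : Continuous θ := h.1.continuous
  let φ : ℝ → ℝ := fun t => ∫ s in (0 : ℝ)..t, θ s
  have hd : ∀ t, HasDerivAt φ (θ t) t := fun t =>
    intervalIntegral.integral_hasDerivAt_right (hc.intervalIntegrable _ _)
      (hc.stronglyMeasurableAtFilter _ _) hc.continuousAt
  have hderiv : deriv φ = θ := funext fun t => (hd t).deriv
  have hsupp : Function.support φ ⊆ Icc a b := by
    intro t ht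
    by_contra hn
    refine ht ?_
    rw [mem_Icc, not_and_or, not_le, not_le] at hn
    rcases hn with hn | hn
    · refine (intervalIntegral.integral_congr fun s hs => ?_).trans
        (intervalIntegral.integral_zero (μ := volume) (a := 0) (b := t))
      refine hzero s fun hs' => ?_
      have := hs.2.trans (max_le ha.le hn.le)
      have h2 := hs.2
      rcases max_choice 0 t with e | e <;> rw [e] at h2 <;> linarith [hs'.1]
    · have e1 : φ t + ∫ s in t..T, θ s = 0 := by
        rw [intervalIntegral.integral_add_adjacent_intervals (hc.intervalIntegrable _ _)
          (hc.intervalIntegrable _ _), intervalIntegral.integral_of_le hT.le,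
          integral_Ioc_eq_integral_Ioo, h0]
      have e2 : ∫ s in t..T, θ s = 0 := by
        refine (intervalIntegral.integral_congr fun s hs => ?_).trans
          (intervalIntegral.integral_zero (μ := volume) (a := t) (b := T))
        refine hzero s fun hs' => ?_
        have h2 := hs.1
        rcases min_choice t T with e | e <;> rw [e] at h2 <;> linarith [hs'.2]
      rw [e2, add_zero] at e1
      exact e1
  have htsupp : tsupport φ ⊆ Icc a b := closure_minimal hsupp isClosed_Icc
  refine ⟨φ, ⟨?_, HasCompactSupport.of_support_subset_isCompact isCompact_Icc hsupp,
    htsupp.trans fun t ht => ⟨ha.trans_le ht.1, ht.2.trans_lt hb⟩⟩, hderiv⟩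
  refine contDiff_infty_iff_deriv.2 ⟨fun t => (hd t).differentiableAt, ?_⟩
  rw [hderiv]
  exact h.1

theorem exists_isTestFunction_integral_eq_one (hT : 0 < T) :
    ∃ ρ : ℝ → ℝ, IsTestFunction (Ioo 0 T) ρ ∧ ∫ t in Ioo 0 T, ρ t = 1 := by
  let b : ContDiffBump (T / 2) := ⟨T / 8, T / 4, by positivity, by linarith⟩
  have hs : tsupport (b.normed volume) ⊆ Ioo 0 T := by
    rw [b.tsupport_normed_eq, Real.closedBall_eq_Icc]
    intro t ht
    have h1 : T / 2 - T / 4 ≤ t := ht.1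
    have h2 : t ≤ T / 2 + T / 4 := ht.2
    exact ⟨by linarith, by linarith⟩
  refine ⟨b.normed volume, ⟨b.contDiff_normed, b.hasCompactSupport_normed, hs⟩, ?_⟩
  rw [setIntegral_eq_integral_of_forall_compl_eq_zero, b.integral_normed]
  exact fun t ht => image_eq_zero_of_notMem_tsupport fun hx => ht (hs hx)

/-- The lemma of du Bois-Reymond: an integrable function with integrable weak derivative is, up to
a constant, the primitive of its derivative. -/
theorem HasWeakTimeDeriv.ae_eq_primitive (hT : 0 < T) {y y' : ℝ → X}
    (hy : Integrable y (timeMeasure T)) (hy' : Integrable y' (timeMeasure T))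
    (h : HasWeakTimeDeriv T y y') :
    ∃ c : X, ∀ᵐ t ∂timeMeasure T, y t = c + ∫ s in Iio t, y' s ∂timeMeasure T := by
  have hW : Integrable (fun t => ∫ s in Iio t, y' s ∂timeMeasure T) (timeMeasure T) :=
    (memLp_primitive_Iio hy' 1).integrable le_rfl
  let z : ℝ → X := fun t => y t - ∫ s in Iio t, y' s ∂timeMeasure T
  have hz : Integrable z (timeMeasure T) := hy.sub hW
  have hz0 : ∀ φ, IsTestFunction (Ioo 0 T) φ → ∫ t in Ioo 0 T, deriv φ t • z t = 0 := by
    intro φ hφ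
    simp only [z, smul_sub]
    rw [integral_sub (integrable_test_smul hφ.continuous_deriv hy)
      (integrable_test_smul hφ.continuous_deriv hW), h φ hφ,
      hasWeakTimeDeriv_primitive hy' φ hφ, sub_self]
  obtain ⟨ρ, hρ, hρ1⟩ := exists_isTestFunction_integral_eq_one hT
  set c : X := ∫ t in Ioo 0 T, ρ t • z t with hcdef
  have hψ : ∀ ψ, IsTestFunction (Ioo 0 T) ψ → ∫ t in Ioo 0 T, ψ t • (z t - c) = 0 := by
    intro ψ hψ
    -- Subtracting a multiple of `ρ` makes the test function a derivative.
    set k := ∫ t in Ioo 0 T, ψ t with hk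
    have hψc := hψ.1.continuous
    have hρc := hρ.1.continuous
    have hψi : Integrable ψ (timeMeasure T) :=
      (memLp_timeMeasure_of_continuous hψc T 1).integrable le_rfl
    have hρi : Integrable ρ (timeMeasure T) :=
      (memLp_timeMeasure_of_continuous hρc T 1).integrable le_rfl
    have hθ : IsTestFunction (Ioo 0 T) (fun t => ψ t - k * ρ t) := by
      refine ⟨hψ.1.sub (contDiff_const.mul hρ.1), hψ.2.1.sub hρ.2.1.mul_left, ?_⟩
      refine (tsupport_sub ψ (fun t => k * ρ t)).trans (union_subset hψ.2.2 ?_)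
      exact (tsupport_mul_subset_right (f := fun _ => k) (g := ρ)).trans hρ.2.2
    have hθ0 : ∫ t in Ioo 0 T, (ψ t - k * ρ t) = 0 := by
      rw [integral_sub hψi (hρi.const_mul k), integral_const_mul, hρ1, mul_one, ← hk, sub_self]
    obtain ⟨φ, hφ, hφ'⟩ := hθ.exists_primitive hT hθ0
    have h1 := hz0 φ hφ
    rw [hφ'] at h1
    simp only [sub_smul, mul_smul] at h1
    have hk2 : Integrable (fun t => k • ρ t • z t) (timeMeasure T) :=
      (integrable_test_smul hρc hz).smul k
    rw [integral_sub (integrable_test_smul hψc hz) hk2, integral_smul] at h1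
    simp only [smul_sub]
    rw [integral_sub (integrable_test_smul hψc hz) (hψi.smul_const c), integral_smul_const,
      ← hk, hcdef]
    exact h1
  have hae := isOpen_Ioo.ae_eq_zero_of_integral_contDiff_smul_eq_zero (U := Ioo 0 T)
    (f := fun t => z t - c) (μ := volume)
    (IntegrableOn.locallyIntegrableOn (hz.sub (integrable_const c)))
    (fun ψ h1 h2 h3 => by
      rw [← setIntegral_eq_integral_of_forall_compl_eq_zero (s := Ioo 0 T) (fun t ht => by
        rw [IsTestFunction.eq_zero ⟨h1, h2, h3⟩ ht, zero_smul])]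
      exact hψ ψ ⟨h1, h2, h3⟩)
  refine ⟨c, ?_⟩
  filter_upwards [(ae_restrict_iff' measurableSet_Ioo).2 hae] with t ht
  rw [← sub_eq_zero, ← ht]
  simp only [z]
  abel

theorem HasWeakTimeDeriv.unique {y y₁ y₂ : ℝ → X} (hy₁ : Integrable y₁ (timeMeasure T))
    (hy₂ : Integrable y₂ (timeMeasure T)) (h₁ : HasWeakTimeDeriv T y y₁)
    (h₂ : HasWeakTimeDeriv T y y₂) : y₁ =ᵐ[timeMeasure T] y₂ := by
  have hae := isOpen_Ioo.ae_eq_zero_of_integral_contDiff_smul_eq_zero (U := Ioo 0 T)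
    (f := fun t => y₁ t - y₂ t) (μ := volume)
    (IntegrableOn.locallyIntegrableOn (hy₁.sub hy₂))
    (fun ψ h1 h2 h3 => by
      have hψ : IsTestFunction (Ioo 0 T) ψ := ⟨h1, h2, h3⟩
      rw [← setIntegral_eq_integral_of_forall_compl_eq_zero (s := Ioo 0 T) (fun t ht => by
        rw [hψ.eq_zero ht, zero_smul])]
      simp only [smul_sub]
      rw [integral_sub (integrable_test_smul h1.continuous hy₁)
        (integrable_test_smul h1.continuous hy₂), ← neg_inj, neg_sub, neg_zero,
        ← neg_neg (∫ t in Ioo 0 T, ψ t • y₂ t), ← h₂ ψ hψ, h₁ ψ hψ]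
      abel)
  filter_upwards [(ae_restrict_iff' measurableSet_Ioo).2 hae] with t ht
  exact sub_eq_zero.1 ht

end WeakDerivative

/-! ### The Yosida approximation of a scalar function and of its Nemytskii operator -/

section Scalar

variable {β βhat : ℝ → ℝ}

theorem exists_scalar_resolvent (hd : ∀ r, HasDerivAt βhat (β r) r) (h0 : βhat 0 = 0)
    (hnn : ∀ r, 0 ≤ βhat r) {l : ℝ} (hl : 0 < l) (x : ℝ) : ∃ s, s + l * β s = x := by
  -- The solution minimizes `s² / 2 + l βhat(s) - x s`.
  let F : ℝ → ℝ := fun s => s ^ 2 / 2 + l * βhat s - x * s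
  have hF : ∀ s, HasDerivAt F (s + l * β s - x) s := by
    intro s
    have h1 : HasDerivAt (fun s : ℝ => s ^ 2 / 2) s s := by
      have := ((hasDerivAt_id s).pow 2).div_const 2
      simpa using this
    have h2 := (h1.add ((hd s).const_mul l)).sub ((hasDerivAt_id s).const_mul x)
    rw [mul_one] at h2
    exact h2
  have hFc : Continuous F := continuous_iff_continuousAt.2 fun s => (hF s).continuousAt
  obtain ⟨s, hs⟩ := hFc.exists_forall_le' 0 (by
    filter_upwards [(isCompact_closedBall (0 : ℝ) (2 * |x|)).compl_mem_cocompact] with s hs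
    simp only [mem_compl_iff, Metric.mem_closedBall, dist_zero_right, Real.norm_eq_abs,
      not_le] at hs
    have h1 := mul_nonneg hl.le (hnn s)
    have h2 := le_abs_self (x * s)
    rw [abs_mul] at h2
    have h3 := sq_abs s
    have h4 : 2 * |x| * |s| ≤ |s| * |s| := by gcongr
    simp only [F, h0]
    nlinarith)
  have h1 : IsLocalMin F s := Eventually.of_forall hs
  have h2 := h1.hasDerivAt_eq_zero (hF s)
  exact ⟨s, by linarith⟩

variable {l : ℝ} {J : ℝ → ℝ}

/-- The scalar Yosida approximation `β ∘ J` is `1 / l`-Lipschitz. -/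
theorem yosida_lipschitzWith (hmono : ∀ r s, 0 ≤ (β r - β s) * (r - s)) (hl : 0 < l)
    (hJ : ∀ x, J x + l * β (J x) = x) : LipschitzWith (Real.toNNReal l⁻¹) (fun x => β (J x)) := by
  refine LipschitzWith.of_dist_le' fun x y => ?_
  rw [Real.dist_eq, Real.dist_eq, inv_mul_eq_div, le_div_iff₀ hl]
  have h1 := hmono (J x) (J y)
  have e : x - y = (J x - J y) + l * (β (J x) - β (J y)) := by
    nth_rewrite 1 [← hJ x, ← hJ y]; ring
  have h2 : l * (β (J x) - β (J y)) ^ 2 ≤ (β (J x) - β (J y)) * (x - y) := by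
    rw [e]; nlinarith
  have h3 := le_abs_self ((β (J x) - β (J y)) * (x - y))
  rw [abs_mul] at h3
  rw [← sq_abs (β (J x) - β (J y))] at h2
  rcases (abs_nonneg (β (J x) - β (J y))).eq_or_lt with h0 | h0
  · rw [← h0, zero_mul]; positivity
  · refine le_of_mul_le_mul_left ?_ h0
    nlinarith

theorem scalar_resolvent_zero (hmono : ∀ r s, 0 ≤ (β r - β s) * (r - s)) (hβ0 : β 0 = 0)
    (hl : 0 < l) (hJ : ∀ x, J x + l * β (J x) = x) : J 0 = 0 := by
  have h1 := hmono (J 0) 0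
  have h2 := hJ 0
  rw [hβ0, sub_zero, sub_zero] at h1
  have h3 : J 0 = -(l * β (J 0)) := by linarith
  have h4 : J 0 * J 0 ≤ 0 := by
    nth_rewrite 1 [h3]
    nlinarith
  exact mul_self_eq_zero.1 (le_antisymm h4 (mul_self_nonneg _))

/-- The Moreau envelope `x ↦ βhat(J x) + (l / 2) β(J x)²` has `x ↦ β(J x)` as a subgradient. -/
theorem moreau_subgradient (hsub : ∀ r s, β r * (s - r) ≤ βhat s - βhat r) (hl : 0 < l)
    (hJ : ∀ x, J x + l * β (J x) = x) (x y : ℝ) :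
    β (J x) * (y - x) ≤ (βhat (J y) + l / 2 * β (J y) ^ 2)
      - (βhat (J x) + l / 2 * β (J x) ^ 2) := by
  have h1 := hsub (J x) (J y)
  have e : y - x = (J y - J x) + l * (β (J y) - β (J x)) := by
    nth_rewrite 1 [← hJ x, ← hJ y]; ring
  rw [e]
  nlinarith [mul_nonneg hl.le (sq_nonneg (β (J y) - β (J x)))]

theorem moreau_le (hsub : ∀ r s, β r * (s - r) ≤ βhat s - βhat r) (hl : 0 < l)
    (hJ : ∀ x, J x + l * β (J x) = x) (x : ℝ) :
    βhat (J x) + l / 2 * β (J x) ^ 2 ≤ βhat x := by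
  have h1 := hsub (J x) x
  have e : x - J x = l * β (J x) := by linarith [hJ x]
  rw [e] at h1
  nlinarith [mul_nonneg hl.le (sq_nonneg (β (J x)))]

/-- The constant is `min_a (c a² + (1 - a)² / (2 l))`; it tends to `c` as `l → 0`. -/
theorem le_moreau {c : ℝ} (hc : 0 < c) (hg : ∀ r, c * |r| ^ 2 ≤ βhat r) (hl : 0 < l)
    (hJ : ∀ x, J x + l * β (J x) = x) (x : ℝ) :
    c / (1 + 2 * l * c) * x ^ 2 ≤ βhat (J x) + l / 2 * β (J x) ^ 2 := by
  have h1 := hg (J x)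
  rw [sq_abs] at h1
  have hpos : 0 < 1 + 2 * l * c := by positivity
  refine le_trans ?_ (add_le_add_left h1 _)
  rw [div_mul_eq_mul_div, div_le_iff₀ hpos]
  nth_rewrite 1 [← hJ x]
  have : (c * J x ^ 2 + l / 2 * β (J x) ^ 2) * (1 + 2 * l * c) - c * (J x + l * β (J x)) ^ 2
      = l / 2 * (2 * c * J x - β (J x)) ^ 2 := by ring
  have := mul_nonneg (half_pos hl).le (sq_nonneg (2 * c * J x - β (J x)))
  linarith

end Scalar

/-- A quadratic bound on the remainder gives differentiability. -/
theorem hasFDerivAt_of_sq_bound {H : Type*} [NormedAddCommGroup H] [InnerProductSpace ℝ H]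
    {E : H → ℝ} {b u : H} {C : ℝ}
    (h : ∀ v, |E v - E u - inner ℝ b (v - u)| ≤ C * ‖v - u‖ ^ 2) :
    HasFDerivAt E (innerSL ℝ b) u := by
  refine HasFDerivAt.of_isLittleO ?_
  refine Asymptotics.IsBigO.trans_isLittleO ?_ (Asymptotics.isLittleO_pow_sub_sub u one_lt_two)
  refine Asymptotics.IsBigO.of_bound C (Eventually.of_forall fun v => ?_)
  rw [Real.norm_eq_abs, Real.norm_of_nonneg (by positivity)]
  exact h v

section Nemytskii

variable {α : Type*} [MeasurableSpace α] {κ : Measure α}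

/-- The graph of the Nemytskii operator `u ↦ β(u)` on `L²`. -/
def nemytskiiGraph (κ : Measure α) (β : ℝ → ℝ) (u w : Lp ℝ 2 κ) : Prop :=
  ∀ᵐ x ∂κ, w x = β (u x)

theorem isMonotoneGraph_nemytskii {β : ℝ → ℝ} (hmono : ∀ r s, 0 ≤ (β r - β s) * (r - s)) :
    IsMonotoneGraph (nemytskiiGraph κ β) := by
  intro u w u' w' h h'
  rw [L2.inner_def]
  refine integral_nonneg_of_ae ?_
  filter_upwards [h, h', Lp.coeFn_sub u u', Lp.coeFn_sub w w'] with x h1 h2 h3 h4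
  rw [h3, h4, Pi.sub_apply, Pi.sub_apply, h1, h2]
  simpa using hmono (u x) (u' x)

/-- The Nemytskii operator of the scalar Yosida approximation is the Yosida approximation of the
Nemytskii operator, and it is the gradient of the integral of the Moreau envelope. -/
theorem exists_isYosida_nemytskii {β βhat : ℝ → ℝ} {c : ℝ}
    (hmono : ∀ r s, 0 ≤ (β r - β s) * (r - s)) (hβ0 : β 0 = 0)
    (hd : ∀ r, HasDerivAt βhat (β r) r) (h0 : βhat 0 = 0) (hnn : ∀ r, 0 ≤ βhat r)
    (hsub : ∀ r s, β r * (s - r) ≤ βhat s - βhat r) (hc : 0 < c)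
    (hg : ∀ r, c * |r| ^ 2 ≤ βhat r) {l : ℝ} (hl : 0 < l) :
    ∃ (B : Lp ℝ 2 κ → Lp ℝ 2 κ) (E : Lp ℝ 2 κ → ℝ),
      IsYosida (nemytskiiGraph κ β) l B E ∧ B 0 = 0 ∧
      (∀ u, c / (1 + 2 * l * c) * ‖u‖ ^ 2 ≤ E u) ∧
      ∀ u : Lp ℝ 2 κ, Integrable (fun x => βhat (u x)) κ → E u ≤ ∫ x, βhat (u x) ∂κ := by
  choose J hJ using exists_scalar_resolvent hd h0 hnn hl
  have hJ0 := scalar_resolvent_zero hmono hβ0 hl hJ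
  have hLip := yosida_lipschitzWith hmono hl hJ
  have hb0 : (fun x => β (J x)) 0 = 0 := by simp [hJ0, hβ0]
  let e : ℝ → ℝ := fun x => βhat (J x) + l / 2 * β (J x) ^ 2
  have hJc : Continuous J := by
    have : J = fun x => x - l * β (J x) := funext fun x => by linarith [hJ x]
    rw [this]
    exact continuous_id.sub (continuous_const.mul hLip.continuous)
  have hec : Continuous e := by
    have h1 : Continuous βhat := continuous_iff_continuousAt.2 fun r => (hd r).continuousAt
    exact (h1.comp hJc).add (continuous_const.mul (hLip.continuous.pow 2))
  have he0 : e 0 = 0 := by simp [e, hJ0, hβ0, h0]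
  have hsubg : ∀ x y, β (J x) * (y - x) ≤ e y - e x := moreau_subgradient hsub hl hJ
  have hbl : ∀ x y, (β (J y) - β (J x)) * (y - x) ≤ l⁻¹ * (y - x) ^ 2 := by
    intro x y
    have h1 := hLip.dist_le_mul y x
    rw [Real.dist_eq, Real.dist_eq, Real.coe_toNNReal _ (inv_pos.2 hl).le] at h1
    calc (β (J y) - β (J x)) * (y - x) ≤ |β (J y) - β (J x)| * |y - x| := by
          rw [← abs_mul]; exact le_abs_self _
      _ ≤ l⁻¹ * |y - x| * |y - x| := by gcongr
      _ = l⁻¹ * (y - x) ^ 2 := by rw [← sq_abs]; ring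
  have hquad : ∀ x y, |e y - e x - β (J x) * (y - x)| ≤ l⁻¹ * (y - x) ^ 2 := by
    intro x y
    rw [abs_of_nonneg (by linarith [hsubg x y])]
    have h1 := hsubg y x
    have h2 := hbl x y
    nlinarith
  have henn : ∀ x, 0 ≤ e x := fun x => by
    have := hnn (J x); positivity
  have hele : ∀ x, e x ≤ l⁻¹ * x ^ 2 := by
    intro x
    have h1 := hquad 0 x
    rw [he0, hJ0, hβ0, zero_mul, sub_zero, sub_zero, sub_zero] at h1
    exact (le_abs_self _).trans h1
  have hsq : ∀ u : Lp ℝ 2 κ, Integrable (fun x => u x ^ 2) κ := fun u => (Lp.memLp u).integrable_sq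
  have hnorm : ∀ u : Lp ℝ 2 κ, ‖u‖ ^ 2 = ∫ x, u x ^ 2 ∂κ := by
    intro u
    rw [← integral_norm_sq_eq]
    simp
  have hei : ∀ u : Lp ℝ 2 κ, Integrable (fun x => e (u x)) κ := by
    intro u
    refine ((hsq u).const_mul l⁻¹).mono' (hec.comp_aestronglyMeasurable (Lp.aestronglyMeasurable u))
      (Eventually.of_forall fun x => ?_)
    rw [Real.norm_of_nonneg (henn _)]
    exact hele _
  let B : Lp ℝ 2 κ → Lp ℝ 2 κ := fun u => hLip.compLp hb0 u
  have hB : ∀ u, ∀ᵐ x ∂κ, B u x = β (J (u x)) := fun u => hLip.coeFn_compLp hb0 u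
  refine ⟨B, fun u => ∫ x, e (u x) ∂κ, ⟨hl, fun u => ?_, fun u => ?_⟩,
    hLip.compLp_zero hb0, fun u => ?_, fun u hu => ?_⟩
  · filter_upwards [hB u, Lp.coeFn_sub u (l • B u), Lp.coeFn_smul l (B u)] with x h1 h2 h3
    rw [h2, Pi.sub_apply, h3, Pi.smul_apply, h1, smul_eq_mul]
    congr 1
    linarith [hJ (u x)]
  · refine hasFDerivAt_of_sq_bound (C := l⁻¹) fun v => ?_
    have e1 : (∫ x, e (v x) ∂κ) - (∫ x, e (u x) ∂κ) - inner ℝ (B u) (v - u)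
        = ∫ x, (e (v x) - e (u x) - inner ℝ (B u x) ((v - u : Lp ℝ 2 κ) x)) ∂κ := by
      have hi := L2.integrable_inner (𝕜 := ℝ) (B u) (v - u)
      have hvu : Integrable (fun x => e (v x) - e (u x)) κ := (hei v).sub (hei u)
      rw [integral_sub hvu hi, integral_sub (hei v) (hei u), L2.inner_def]
    rw [e1, hnorm, ← integral_const_mul, ← Real.norm_eq_abs]
    refine norm_integral_le_of_norm_le ((hsq _).const_mul _) ?_
    filter_upwards [hB u, Lp.coeFn_sub v u] with x h1 h2
    rw [h1, h2, Pi.sub_apply, Real.norm_eq_abs]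
    have h3 := hquad (u x) (v x)
    simpa [mul_comm] using h3
  · rw [hnorm, ← integral_const_mul]
    exact integral_mono ((hsq u).const_mul _) (hei u) fun x => le_moreau hc hg hl hJ (u x)
  · exact integral_mono (hei u) hu fun x => moreau_le hsub hl hJ (u x)

end Nemytskii

/-! ### The space `H¹(Ω)` -/

section Sobolev

variable {N : ℕ} {Ω : Set (RN N)}

theorem isClosed_sobolevH1 : IsClosed (sobolevH1 Ω : Set (WithLp 2 (SpaceH Ω × SpaceHvec Ω))) := by
  -- Membership is a family of continuous linear equations, indexed by test functions.
  have e : (sobolevH1 Ω : Set (WithLp 2 (SpaceH Ω × SpaceHvec Ω)))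
      = ⋂ (φ : RN N → ℝ) (hφ : IsTestFunction Ω φ) (e : RN N),
        {p | inner ℝ (hφ.memLp_fderiv e).toLp (WithLp.fstL 2 ℝ (SpaceH Ω) (SpaceHvec Ω) p)
          = -inner ℝ hφ.memLp.toLp ((innerSL ℝ e).compLpL 2 (volume.restrict Ω)
            (WithLp.sndL 2 ℝ (SpaceH Ω) (SpaceHvec Ω) p))} := by
    ext p
    simp only [mem_iInter, mem_ofPred_eq]
    refine forall_congr' fun φ => forall_congr' fun hφ => forall_congr' fun e => ?_
    have h1 : inner ℝ (hφ.memLp_fderiv e).toLp p.fst = ∫ x in Ω, p.fst x * fderiv ℝ φ x e := by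
      rw [L2.inner_def]
      refine integral_congr_ae ?_
      filter_upwards [(hφ.memLp_fderiv e).coeFn_toLp] with x hx
      rw [hx]; simp
    have h2 : inner ℝ hφ.memLp.toLp ((innerSL ℝ e).compLpL 2 (volume.restrict Ω) p.snd)
        = ∫ x in Ω, φ x * inner ℝ (p.snd x) e := by
      rw [L2.inner_def]
      refine integral_congr_ae ?_
      filter_upwards [hφ.memLp.coeFn_toLp,
        (innerSL ℝ e).coeFn_compLpL (p := 2) (μ := volume.restrict Ω) p.snd] with x hx hx'
      rw [hx, hx', innerSL_apply_apply, real_inner_comm (p.snd x) e]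
      simp [mul_comm]
    change _ ↔ inner ℝ _ p.fst = -inner ℝ _ ((innerSL ℝ e).compLpL 2 (volume.restrict Ω) p.snd)
    rw [h1, h2]
  rw [e]
  exact isClosed_iInter fun φ => isClosed_iInter fun hφ => isClosed_iInter fun e =>
    isClosed_eq (by fun_prop) (by fun_prop)

instance : CompleteSpace (SpaceV Ω) := isClosed_sobolevH1.completeSpace_coe

/-- Test functions belong to `H¹(Ω)`. -/
theorem IsTestFunction.exists_toH_eq {φ : RN N → ℝ} (hφ : IsTestFunction Ω φ) :
    ∃ z : SpaceV Ω, ∀ᵐ x ∂volume.restrict Ω, toH z x = φ x := by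
  have hfc : Continuous (fderiv ℝ φ) := hφ.1.continuous_fderiv (by simp)
  have hgc : Continuous (gradient φ) := by
    unfold gradient
    exact (InnerProductSpace.toDual ℝ (RN N)).symm.continuous.comp hfc
  have hgs : HasCompactSupport (gradient φ) := by
    unfold gradient
    exact (hφ.2.1.fderiv ℝ).comp_left (map_zero _)
  have hg : MemLp (gradient φ) 2 (volume.restrict Ω) :=
    (hgc.memLp_of_hasCompactSupport (μ := volume) hgs).restrict Ω
  have hmem : WithLp.toLp 2 ((hφ.memLp.toLp : SpaceH Ω), (hg.toLp : SpaceHvec Ω)) ∈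
      sobolevH1 Ω := by
    intro ψ hψ e
    have hψc := hψ.1.continuous
    have hφc := hφ.1.continuous
    have hψf : Continuous (fun x => fderiv ℝ ψ x e) :=
      (hψ.1.continuous_fderiv (by simp)).clm_apply continuous_const
    have hφf : Continuous (fun x => fderiv ℝ φ x e) := hfc.clm_apply continuous_const
    have h1 : ∫ x in Ω, (hφ.memLp.toLp : SpaceH Ω) x * fderiv ℝ ψ x e
        = ∫ x, φ x * fderiv ℝ ψ x e := by
      rw [← setIntegral_eq_integral_of_forall_compl_eq_zero (s := Ω)
        (f := fun x => φ x * fderiv ℝ ψ x e) (fun x hx => by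
        rw [image_eq_zero_of_notMem_tsupport fun h => hx (hφ.2.2 h), zero_mul])]
      refine integral_congr_ae ?_
      filter_upwards [hφ.memLp.coeFn_toLp] with x hx
      rw [hx]
    have h2 : ∫ x in Ω, ψ x * inner ℝ ((hg.toLp : SpaceHvec Ω) x) e
        = ∫ x, fderiv ℝ φ x e * ψ x := by
      rw [← setIntegral_eq_integral_of_forall_compl_eq_zero (s := Ω)
        (f := fun x => fderiv ℝ φ x e * ψ x) (fun x hx => by
        rw [image_eq_zero_of_notMem_tsupport fun h => hx (hψ.2.2 h), mul_zero])]
      refine integral_congr_ae ?_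
      filter_upwards [hg.coeFn_toLp] with x hx
      rw [hx, inner_gradient_left, mul_comm]
    refine h1.trans (Eq.trans ?_ (congrArg Neg.neg h2.symm))
    exact integral_mul_fderiv_eq_neg_fderiv_mul_of_integrable
      ((hφf.mul hψc).integrable_of_hasCompactSupport hψ.2.1.mul_left)
      ((hφc.mul hψf).integrable_of_hasCompactSupport hφ.2.1.mul_right)
      ((hφc.mul hψc).integrable_of_hasCompactSupport hφ.2.1.mul_right)
      (fun x _ => (hφ.1.differentiable (by simp)).differentiableAt)
      (fun x _ => (hψ.1.differentiable (by simp)).differentiableAt)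
  exact ⟨⟨_, hmem⟩, hφ.memLp.coeFn_toLp⟩

/-- `H¹(Ω)` is dense in `L²(Ω)`, since it contains the test functions. -/
theorem eq_zero_of_adjoint_toH_eq_zero (hΩ : IsOpen Ω) (h : SpaceH Ω)
    (h0 : (toH (Ω := Ω)).adjoint h = 0) : h = 0 := by
  have hz : ∀ z : SpaceV Ω, inner ℝ h (toH z) = 0 := fun z => by
    rw [← ContinuousLinearMap.adjoint_inner_left, h0, inner_zero_left]
  have hloc : LocallyIntegrableOn h Ω volume := by
    refine (locallyIntegrableOn_iff hΩ.isLocallyClosed).2 fun K hK hKc => ?_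
    have : IsFiniteMeasure ((volume.restrict Ω).restrict K) :=
      ⟨by
        rw [Measure.restrict_restrict hKc.measurableSet]
        simpa using (measure_mono inter_subset_left).trans_lt hKc.measure_lt_top⟩
    have h1 : MemLp h 2 ((volume.restrict Ω).restrict K) := (Lp.memLp h).restrict K
    have h2 := h1.integrable (by norm_num)
    rwa [Measure.restrict_restrict hKc.measurableSet, inter_eq_left.2 hK] at h2
  have hae := hΩ.ae_eq_zero_of_integral_contDiff_smul_eq_zero hloc fun φ h1 h2 h3 => by
    have hφ : IsTestFunction Ω φ := ⟨h1, h2, h3⟩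
    obtain ⟨z, hzφ⟩ := hφ.exists_toH_eq
    rw [← setIntegral_eq_integral_of_forall_compl_eq_zero (s := Ω) (fun x hx => by
      rw [image_eq_zero_of_notMem_tsupport fun h => hx (h3 h), zero_smul]), ← hz z, L2.inner_def]
    refine integral_congr_ae ?_
    filter_upwards [hzφ] with x hx
    rw [hx]; simp
  refine (Lp.eq_zero_iff_ae_eq_zero).2 ?_
  exact (ae_restrict_iff' hΩ.measurableSet).2 hae

end Sobolev

/-! ### The Riesz map and functions of time -/

section Riesz

variable {V : Type*} [NormedAddCommGroup V] [InnerProductSpace ℝ V]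

theorem innerSL_injective : Function.Injective (innerSL ℝ : V → StrongDual ℝ V) := fun _ _ h =>
  ext_inner_right ℝ fun z => congrArg (fun L : StrongDual ℝ V => L z) h

theorem continuousOn_innerSL {y : ℝ → V} {s : Set ℝ} (hy : ContinuousOn y s) :
    ContinuousOn (fun t => (innerSL ℝ (y t) : StrongDual ℝ V)) s :=
  (innerSL ℝ).continuous.comp_continuousOn hy

theorem continuousOn_of_innerSL {y : ℝ → V} {s : Set ℝ}
    (hy : ContinuousOn (fun t => (innerSL ℝ (y t) : StrongDual ℝ V)) s) : ContinuousOn y s := by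
  exact ((InnerProductSpace.toDualMap ℝ V).isometry.isUniformInducing.isInducing.continuousOn_iff).2
    hy

theorem exists_innerSL_eq [CompleteSpace V] (L : StrongDual ℝ V) : ∃ v : V, innerSL ℝ v = L :=
  (InnerProductSpace.toDual ℝ V).surjective L

/-- The Riesz map, here `innerSL ℝ`, identifies weak derivatives with values in `V` and in its
dual. -/
theorem hasWeakTimeDeriv_innerSL_iff [CompleteSpace V] {T : ℝ} {y y' : ℝ → V}
    (hy : Integrable y (timeMeasure T)) (hy' : Integrable y' (timeMeasure T)) :
    HasWeakTimeDeriv T (fun t => (innerSL ℝ (y t) : StrongDual ℝ V))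
      (fun t => (innerSL ℝ (y' t) : StrongDual ℝ V)) ↔ HasWeakTimeDeriv T y y' := by
  let L : V →L[ℝ] StrongDual ℝ V := innerSL ℝ
  refine forall_congr' fun φ => forall_congr' fun hφ => ?_
  have h1 : ∫ t in Ioo 0 T, deriv φ t • L (y t) = L (∫ t in Ioo 0 T, deriv φ t • y t) := by
    rw [← L.integral_comp_comm (integrable_test_smul hφ.continuous_deriv hy)]
    simp only [map_smul]
  have h2 : ∫ t in Ioo 0 T, φ t • L (y' t) = L (∫ t in Ioo 0 T, φ t • y' t) := by
    rw [← L.integral_comp_comm (integrable_test_smul hφ.1.continuous hy')]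
    simp only [map_smul]
  change ∫ t in Ioo 0 T, deriv φ t • L (y t) = -∫ t in Ioo 0 T, φ t • L (y' t) ↔ _
  rw [h1, h2, ← map_neg]
  exact innerSL_injective.eq_iff

theorem exists_Lp_neg_innerSL {T : ℝ} (m : Lp V 2 (timeMeasure T)) :
    ∃ w : Lp (StrongDual ℝ V) 2 (timeMeasure T), (∀ᵐ t ∂timeMeasure T, w t = -innerSL ℝ (m t)) ∧
      ∀ t ∈ Icc 0 T, ∫ s in (0 : ℝ)..t, ‖w s‖ ^ 2 = ∫ s in (0 : ℝ)..t, ‖m s‖ ^ 2 := by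
  let L : V →L[ℝ] StrongDual ℝ V := innerSL ℝ
  have h : ∀ᵐ t ∂timeMeasure T, (-L).compLp m t = -innerSL ℝ (m t) := by
    filter_upwards [(-L).coeFn_compLp m] with t ht
    rw [ht]
    rfl
  refine ⟨(-L).compLp m, h, fun t ht => ?_⟩
  rw [intervalIntegral_eq_setIntegral_Iio ht, intervalIntegral_eq_setIntegral_Iio ht]
  refine integral_congr_ae (ae_restrict_of_ae ?_)
  filter_upwards [h] with s hs
  rw [hs, norm_neg, innerSL_apply_norm]

theorem integral_norm_add_sq_le {T : ℝ} (m f : Lp V 2 (timeMeasure T)) {t : ℝ}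
    (ht : t ∈ Icc 0 T) : ∫ s in (0 : ℝ)..t, ‖(m + f : Lp V 2 (timeMeasure T)) s‖ ^ 2
      ≤ 2 * (∫ s in (0 : ℝ)..t, ‖m s‖ ^ 2) + 2 * ‖f‖ ^ 2 := by
  have hm2 : Integrable (fun s => ‖m s‖ ^ 2) (timeMeasure T) :=
    (Lp.memLp m).integrable_norm_pow two_ne_zero
  have hf2 : Integrable (fun s => ‖f s‖ ^ 2) (timeMeasure T) :=
    (Lp.memLp f).integrable_norm_pow two_ne_zero
  have hb2 : Integrable (fun s => ‖(m + f : Lp V 2 (timeMeasure T)) s‖ ^ 2)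
      (timeMeasure T) := (Lp.memLp (m + f)).integrable_norm_pow two_ne_zero
  have h1 : ∫ s in Iio t, ‖(m + f : Lp V 2 (timeMeasure T)) s‖ ^ 2 ∂timeMeasure T
      ≤ 2 * (∫ s in Iio t, ‖m s‖ ^ 2 ∂timeMeasure T)
        + 2 * ∫ s in Iio t, ‖f s‖ ^ 2 ∂timeMeasure T := by
    rw [← integral_const_mul, ← integral_const_mul,
      ← integral_add (hm2.restrict.const_mul 2) (hf2.restrict.const_mul 2)]
    refine integral_mono_ae hb2.restrict
      ((hm2.restrict.const_mul 2).add (hf2.restrict.const_mul 2)) (ae_restrict_of_ae ?_)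
    filter_upwards [Lp.coeFn_add m f] with s hs
    have h2 := parallelogram_law_with_norm ℝ (m s) (f s)
    have h3 := mul_self_nonneg ‖m s - f s‖
    simp only [hs, Pi.add_apply]
    nlinarith
  have h2 : ∫ s in Iio t, ‖f s‖ ^ 2 ∂timeMeasure T ≤ ‖f‖ ^ 2 := by
    rw [← integral_norm_sq_eq]
    exact setIntegral_le_integral hf2 (Eventually.of_forall fun _ => sq_nonneg _)
  rw [intervalIntegral_eq_setIntegral_Iio ht, intervalIntegral_eq_setIntegral_Iio ht]
  linarith

end Riesz

section Primitive

variable {T : ℝ} {E : Type*} [NormedAddCommGroup E] [NormedSpace ℝ E]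

/-- A primitive of `m` in the interval notation and in terms of the measure on `(0, T)`. -/
theorem integral_Iio_eq (m : ℝ → E) :
    ∀ᵐ t ∂timeMeasure T, ∫ s in Iio t, m s ∂timeMeasure T = ∫ s in (0 : ℝ)..t, m s := by
  filter_upwards [ae_restrict_mem measurableSet_Ioo] with t ht
  rw [intervalIntegral_eq_setIntegral_Iio ⟨ht.1.le, ht.2.le⟩]

theorem continuousOn_primitive_Icc (hT : 0 < T) {m : ℝ → E} (hm : Integrable m (timeMeasure T)) :
    ContinuousOn (fun t => ∫ s in (0 : ℝ)..t, m s) (Icc 0 T) := by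
  have h := intervalIntegral.continuousOn_primitive_interval (μ := volume) (a := 0) (b := T)
    (f := m) (by rw [uIcc_of_le hT.le]; exact (integrableOn_Icc_iff_integrableOn_Ioo).2 hm)
  rwa [uIcc_of_le hT.le] at h

end Primitive

/-! ### Weak solutions as evolutions in `H¹(Ω)` -/

section WeakSolution

variable {N : ℕ} {Ω : Set (RN N)}

/-- The embedding `H → V*` is the Riesz map composed with the adjoint of `V → H`. -/
theorem toVdual_eq (h : SpaceH Ω) :
    toVdual h = (innerSL ℝ ((toH (Ω := Ω)).adjoint h) : SpaceVdual Ω) := by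
  ext z
  rw [innerSL_apply_apply, ContinuousLinearMap.adjoint_inner_left]
  rfl

variable {T : ℝ} {β : ℝ → ℝ} {f : Lp (SpaceV Ω) 2 (timeMeasure T)} {u₀ : SpaceH Ω}

theorem integrable_adjoint_toH (u : Lp (SpaceH Ω) ∞ (timeMeasure T)) :
    Integrable (fun t => (toH (Ω := Ω)).adjoint (u t)) (timeMeasure T) :=
  (toH (Ω := Ω)).adjoint.integrable_comp ((Lp.memLp u).integrable (by simp))

theorem IsWeakSolution.hasWeakTimeDeriv {u : Lp (SpaceH Ω) ∞ (timeMeasure T)}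
    {μ : Lp (SpaceV Ω) 2 (timeMeasure T)} (h : IsWeakSolution T β f u₀ u μ) :
    HasWeakTimeDeriv T (fun t => (toH (Ω := Ω)).adjoint (u t)) (fun t => -μ t) := by
  obtain ⟨u', hu', heq⟩ := h.equation
  have hμi : Integrable μ (timeMeasure T) := (Lp.memLp μ).integrable (by norm_num)
  refine (hasWeakTimeDeriv_innerSL_iff (integrable_adjoint_toH u) hμi.neg).1 fun φ hφ => ?_
  simp only [← toVdual_eq]
  refine (hu' φ hφ).trans (congrArg Neg.neg ?_)
  refine integral_congr_ae ?_
  filter_upwards [heq] with t ht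
  congr 1
  ext z
  rw [innerSL_apply_apply, Pi.neg_apply, inner_neg_left]
  linarith [ht z]

/-- The integrated equation, with the initial value identified through the continuous
representative of `u`. -/
theorem IsWeakSolution.adjoint_eq (hT : 0 < T) {u : Lp (SpaceH Ω) ∞ (timeMeasure T)}
    {μ : Lp (SpaceV Ω) 2 (timeMeasure T)} (h : IsWeakSolution T β f u₀ u μ) :
    ∀ᵐ t ∂timeMeasure T, (toH (Ω := Ω)).adjoint (u t)
      = (toH (Ω := Ω)).adjoint u₀ - ∫ s in Iio t, μ s ∂timeMeasure T := by
  have hμi : Integrable μ (timeMeasure T) := (Lp.memLp μ).integrable (by norm_num)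
  obtain ⟨c, hc⟩ : ∃ c : SpaceV Ω, ∀ᵐ t ∂timeMeasure T, (toH (Ω := Ω)).adjoint (u t)
      = c + ∫ s in Iio t, -μ s ∂timeMeasure T :=
    h.hasWeakTimeDeriv.ae_eq_primitive hT (integrable_adjoint_toH u) hμi.neg
  obtain ⟨U, hUc, hUu, hU0⟩ := h.initial
  choose Y hY using fun t => exists_innerSL_eq (U t)
  have hYc : ContinuousOn Y (Icc 0 T) := by
    refine continuousOn_of_innerSL ?_
    simp only [hY]
    exact hUc
  have hY0 : Y 0 = (toH (Ω := Ω)).adjoint u₀ :=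
    innerSL_injective (by rw [hY, hU0, toVdual_eq])
  let P : ℝ → SpaceV Ω := fun t => c + ∫ s in (0 : ℝ)..t, -μ s
  have hP : ContinuousOn P (Icc 0 T) :=
    continuousOn_const.add (continuousOn_primitive_Icc hT hμi.neg)
  have hYP : EqOn Y P (Icc 0 T) := by
    refine Measure.eqOn_Icc_of_ae_eq volume hT.ne ?_ hYc hP
    rw [← restrict_Ioo_eq_restrict_Icc]
    filter_upwards [hc, hUu, integral_Iio_eq (fun s => -μ s)] with t h1 h2 h3
    refine innerSL_injective ?_
    rw [hY, h2, toVdual_eq, h1, h3]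
  have hc0 : c = (toH (Ω := Ω)).adjoint u₀ := by
    rw [← hY0, hYP ⟨le_rfl, hT.le⟩]
    simp [P]
  filter_upwards [hc] with t ht
  rw [ht, hc0, integral_neg, sub_eq_add_neg]

theorem IsWeakSolution.graph {u : Lp (SpaceH Ω) ∞ (timeMeasure T)}
    {μ : Lp (SpaceV Ω) 2 (timeMeasure T)} (h : IsWeakSolution T β f u₀ u μ) :
    ∀ᵐ t ∂timeMeasure T, nemytskiiGraph (volume.restrict Ω) β (u t) (toH (μ t + f t)) := by
  filter_upwards [h.constitutive] with t ht
  filter_upwards [ht, Lp.coeFn_add (toH (μ t)) (toH (f t))] with x h1 h2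
  rw [map_add, h2, Pi.add_apply, h1]
  ring

theorem IsWeakSolution.unique (hΩ : IsOpen Ω) (hT : 0 < T)
    (hmono : ∀ r s, 0 ≤ (β r - β s) * (r - s))
    {u₁ u₂ : Lp (SpaceH Ω) ∞ (timeMeasure T)} {μ₁ μ₂ : Lp (SpaceV Ω) 2 (timeMeasure T)}
    (h₁ : IsWeakSolution T β f u₀ u₁ μ₁) (h₂ : IsWeakSolution T β f u₀ u₂ μ₂) :
    u₁ = u₂ ∧ μ₁ = μ₂ := by
  have hi₁ : Integrable μ₁ (timeMeasure T) := (Lp.memLp μ₁).integrable (by norm_num)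
  have hi₂ : Integrable μ₂ (timeMeasure T) := (Lp.memLp μ₂).integrable (by norm_num)
  have hw := eq_zero_of_monotone (ν := timeMeasure T) toH
    (eq_zero_of_adjoint_toH_eq_zero hΩ) (w := fun t => u₁ t - u₂ t)
    (m := fun t => μ₁ t - μ₂ t) ((Lp.memLp μ₁).sub (Lp.memLp μ₂))
    (by
      filter_upwards [h₁.adjoint_eq hT, h₂.adjoint_eq hT] with t h3 h4
      rw [map_sub, h3, h4, integral_sub hi₁.restrict hi₂.restrict]
      abel)
    (by
      filter_upwards [h₁.graph, h₂.graph] with t h3 h4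
      have := isMonotoneGraph_nemytskii hmono h3 h4
      rwa [← map_sub, add_sub_add_right_eq_sub] at this)
  have hu : u₁ = u₂ := by
    refine Lp.ext ?_
    filter_upwards [hw] with t ht
    exact sub_eq_zero.1 ht
  refine ⟨hu, Lp.ext ?_⟩
  subst hu
  filter_upwards [h₁.hasWeakTimeDeriv.unique hi₁.neg hi₂.neg h₂.hasWeakTimeDeriv] with t ht
  exact neg_injective ht

end WeakSolution

section Existence

variable {N : ℕ} {Ω : Set (RN N)}

/-- The abstract evolution theorem for the Nemytskii operator of `β` and the embedding of `H¹(Ω)`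
into `L²(Ω)`. -/
theorem exists_evolution_toH (hΩ : IsOpen Ω) {T : ℝ} (hT : 0 < T) {β βhat : ℝ → ℝ} {c₁ : ℝ}
    (hβ : BetaAssumptions Ω β βhat c₁) (f : Lp (SpaceV Ω) 2 (timeMeasure T)) (u₀ : SpaceH Ω)
    (hu₀ : Integrable (fun x => βhat (u₀ x)) (volume.restrict Ω)) :
    ∃ (U : ℝ → SpaceH Ω) (m : Lp (SpaceV Ω) 2 (timeMeasure T)),
      AEStronglyMeasurable U (timeMeasure T) ∧
      (∀ t ∈ Icc 0 T, (toH (Ω := Ω)).adjoint (U t)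
        = (toH (Ω := Ω)).adjoint u₀ - ∫ s in (0 : ℝ)..t, m s) ∧
      (∀ t ∈ Icc 0 T, (∫ s in (0 : ℝ)..t, ‖m s‖ ^ 2) + 2 * c₁ * ‖U t‖ ^ 2
        ≤ 2 * (∫ x in Ω, βhat (u₀ x)) + ‖f‖ ^ 2) ∧
      ∀ᵐ t ∂timeMeasure T, nemytskiiGraph (volume.restrict Ω) β (U t) (toH (m t + f t)) := by
  have hmono := hβ.maximalMonotone.1
  have hβ0 : β 0 = 0 :=
    IsLocalMin.hasDerivAt_eq_zero (f := βhat)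
      (Eventually.of_forall fun r => by rw [hβ.map_zero]; exact hβ.nonneg r) (hβ.hasDerivAt 0)
  have hsub : ∀ r s, β r * (s - r) ≤ βhat s - βhat r := fun r s =>
    (show β r ∈ subdifferential βhat r by rw [hβ.subdifferential_eq]; rfl) s
  have hex := fun {l : ℝ} (hl : 0 < l) => exists_isYosida_nemytskii (κ := volume.restrict Ω) hmono
    hβ0 hβ.hasDerivAt hβ.map_zero hβ.nonneg hsub hβ.c₁_pos hβ.quadratic_growth hl
  have hc₁ := hβ.c₁_pos
  let l : ℕ → ℝ := fun n => 1 / ((n : ℝ) + 1)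
  have hl : Tendsto l atTop (𝓝 0) := tendsto_one_div_add_atTop_nhds_zero_nat
  have hl0 : ∀ n, 0 < l n := fun n => by positivity
  have hl1 : ∀ n, l n ≤ 1 := fun n => by
    rw [div_le_one (by positivity)]
    linarith [n.cast_nonneg (α := ℝ)]
  choose B E hY hB0 hEc hEu using fun n => hex (hl0 n)
  obtain ⟨B₁, E₁, hY₁, hB₁, -, -⟩ := hex one_pos
  have hc : Tendsto (fun n => c₁ / (1 + 2 * l n * c₁)) atTop (𝓝 c₁) := by
    have h1 : Tendsto (fun n => 1 + 2 * l n * c₁) atTop (𝓝 1) := by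
      simpa using ((hl.const_mul 2).mul_const c₁).const_add 1
    have h2 := (tendsto_const_nhds (x := c₁)).div h1 one_ne_zero
    rwa [div_one] at h2
  refine exists_evolution toH (eq_zero_of_adjoint_toH_eq_zero hΩ)
    (isMonotoneGraph_nemytskii hmono) hY hl hc (δ := c₁ / (1 + 2 * 1 * c₁)) (by positivity)
    (fun n => ?_) hEc (R := fun u => u - B₁ u) (fun u => ?_) (by simp [hB₁]) hT f u₀
    (fun n => hEu n u₀ hu₀)
  · have := hl0 n
    have := hl1 n
    gcongr
  · have := hY₁.mem u
    rw [one_smul] at this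
    simpa using this

/-- Existence of a weak solution that satisfies the energy estimates. -/
theorem exists_isWeakSolution (hΩ : IsOpen Ω) {T : ℝ} (hT : 0 < T) {β βhat : ℝ → ℝ} {c₁ : ℝ}
    (hβ : BetaAssumptions Ω β βhat c₁) (f : Lp (SpaceV Ω) 2 (timeMeasure T)) (u₀ : SpaceH Ω)
    (hu₀ : Integrable (fun x => βhat (u₀ x)) (volume.restrict Ω))
    (M₁ : ℝ) (hM₁ : M₁ = 2 * (∫ x in Ω, βhat (u₀ x)) + ‖f‖ ^ 2) :
    ∃ (u : Lp (SpaceH Ω) ⊤ (timeMeasure T)) (μ : Lp (SpaceV Ω) 2 (timeMeasure T)),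
      IsWeakSolution T β f u₀ u μ ∧
      ∃ (U : ℝ → SpaceH Ω) (u' : Lp (SpaceVdual Ω) 2 (timeMeasure T))
        (b : Lp (SpaceV Ω) 2 (timeMeasure T)),
        (∀ᵐ t ∂timeMeasure T, U t = u t) ∧
        ContinuousOn (fun t => toVdual (U t)) (Icc 0 T) ∧
        U 0 = u₀ ∧
        HasWeakTimeDeriv T (fun t => toVdual (u t)) u' ∧
        (∀ᵐ t ∂timeMeasure T, ∀ᵐ x ∂volume.restrict Ω, toH (b t) x = β (u t x)) ∧
        ∀ t ∈ Icc 0 T,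
          (∫ s in (0 : ℝ)..t, ‖u' s‖ ^ 2) + 2 * c₁ * ‖U t‖ ^ 2 ≤ M₁ ∧
          (∫ s in (0 : ℝ)..t, ‖μ s‖ ^ 2) ≤ M₁ ∧
          (∫ s in (0 : ℝ)..t, ‖b s‖ ^ 2) ≤ 2 * (M₁ + ‖f‖ ^ 2) := by
  obtain ⟨U, m, hUm, hUeq, hest, hgr⟩ := exists_evolution_toH hΩ hT hβ f u₀ hu₀
  rw [← hM₁] at hest
  have hc₁ := hβ.c₁_pos
  have hmi : Integrable m (timeMeasure T) := (Lp.memLp m).integrable (by norm_num)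
  have hmem : ∀ᵐ t ∂timeMeasure T, t ∈ Icc 0 T := by
    filter_upwards [ae_restrict_mem measurableSet_Ioo] with t ht
    exact ⟨ht.1.le, ht.2.le⟩
  have hint : ∀ t ∈ Icc 0 T, 0 ≤ ∫ s in (0 : ℝ)..t, ‖m s‖ ^ 2 := fun t ht =>
    intervalIntegral.integral_nonneg ht.1 fun _ _ => sq_nonneg _
  have hUL : MemLp U ⊤ (timeMeasure T) := by
    refine MemLp.of_bound hUm (Real.sqrt (M₁ / (2 * c₁))) ?_
    filter_upwards [hmem] with t ht
    refine Real.le_sqrt_of_sq_le ?_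
    rw [le_div_iff₀ (by positivity)]
    linarith [hest t ht, hint t ht]
  obtain ⟨u, hu⟩ : ∃ u : Lp (SpaceH Ω) ⊤ (timeMeasure T), ∀ᵐ t ∂timeMeasure T, u t = U t :=
    ⟨hUL.toLp, hUL.coeFn_toLp⟩
  obtain ⟨u', hu', hu'm⟩ := exists_Lp_neg_innerSL m
  have hderiv : HasWeakTimeDeriv T (fun t => toVdual (u t)) u' := by
    have h1 : HasWeakTimeDeriv T (fun t => (toH (Ω := Ω)).adjoint (u t)) (fun t => -m t) := by
      intro φ hφ
      have h2 := hasWeakTimeDeriv_primitive hmi φ hφ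
      have h3 := hφ.integral_deriv_smul_const hT ((toH (Ω := Ω)).adjoint u₀)
      have hc := hφ.continuous_deriv
      have e : ∫ t in Ioo 0 T, deriv φ t • (toH (Ω := Ω)).adjoint (u t)
          = ∫ t in Ioo 0 T, (deriv φ t • (toH (Ω := Ω)).adjoint u₀
            - deriv φ t • ∫ s in Iio t, m s ∂timeMeasure T) := by
        refine integral_congr_ae ?_
        filter_upwards [hu, hmem, integral_Iio_eq m] with t h4 h5 h6
        rw [h4, hUeq t h5, h6, smul_sub]
      rw [e, integral_sub (integrable_test_smul hc (integrable_const _))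
        (integrable_test_smul hc ((memLp_primitive_Iio hmi 1).integrable le_rfl)), h3, h2]
      simp only [smul_neg, integral_neg]
      abel
    have h2 := (hasWeakTimeDeriv_innerSL_iff (integrable_adjoint_toH u) hmi.neg).2 h1
    intro φ hφ
    simp only [toVdual_eq]
    refine (h2 φ hφ).trans (congrArg Neg.neg (integral_congr_ae ?_))
    filter_upwards [hu'] with t ht
    rw [ht]
    simp
  have hcont : ContinuousOn (fun t => toVdual (U t)) (Icc 0 T) := by
    simp only [toVdual_eq]
    refine continuousOn_innerSL ?_
    exact (continuousOn_const.sub (continuousOn_primitive_Icc hT hmi)).congr hUeq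
  have hU0 : U 0 = u₀ := by
    rw [← sub_eq_zero]
    refine eq_zero_of_adjoint_toH_eq_zero hΩ _ ?_
    rw [map_sub, hUeq 0 ⟨le_rfl, hT.le⟩]
    simp
  have hb : ∀ᵐ t ∂timeMeasure T, ∀ᵐ x ∂volume.restrict Ω,
      toH ((m + f : Lp (SpaceV Ω) 2 (timeMeasure T)) t) x = β (u t x) := by
    filter_upwards [hgr, hu, Lp.coeFn_add m f] with t h1 h2 h3
    rw [h2, h3]
    exact h1
  refine ⟨u, m, ⟨⟨u', hderiv, ?_⟩, ?_, ⟨fun t => toVdual (U t), hcont, ?_, ?_⟩⟩,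
    U, u', m + f, ?_, hcont, hU0, hderiv, hb, fun t ht => ⟨?_, ?_, ?_⟩⟩
  · filter_upwards [hu'] with t ht z
    rw [ht]
    exact neg_add_cancel _
  · filter_upwards [hgr, hu] with t h1 h2
    filter_upwards [h1, Lp.coeFn_add (toH (m t)) (toH (f t))] with x h3 h4
    rw [map_add, h4, Pi.add_apply] at h3
    rw [h2, ← h3]
    ring
  · filter_upwards [hu] with t ht
    rw [ht]
  · exact congrArg toVdual hU0
  · filter_upwards [hu] with t ht
    rw [ht]
  · exact (congrArg (· + 2 * c₁ * ‖U t‖ ^ 2) (hu'm t ht)).trans_le (hest t ht)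
  · have := mul_nonneg hc₁.le (sq_nonneg ‖U t‖)
    linarith [hest t ht]
  · refine (integral_norm_add_sq_le m f ht).trans ?_
    have := mul_nonneg hc₁.le (sq_nonneg ‖U t‖)
    linarith [hest t ht]

end Existence

end PorousMedium

open PorousMedium MeasureTheory Set in
theorem theorem1p1 {N : ℕ} (Ω : Set (RN N)) (hΩ : IsOpen Ω) (T : ℝ) (hT : 0 < T)
    (β βhat : ℝ → ℝ) (c₁ : ℝ) (hβ : BetaAssumptions Ω β βhat c₁)
    (g : Lp (SpaceH Ω) 2 (timeMeasure T))
    (f : Lp (SpaceV Ω) 2 (timeMeasure T)) (hf : SolvesNeumann T f g)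
    (u₀ : SpaceH Ω) (hu₀ : Integrable (fun x => βhat (u₀ x)) (volume.restrict Ω))
    (M₁ : ℝ) (hM₁ : M₁ = 2 * (∫ x in Ω, βhat (u₀ x)) + ‖f‖ ^ 2) :
    -- existence and uniqueness in `L^∞(0,T;H) × L²(0,T;V)`
    (∃! p : Lp (SpaceH Ω) ⊤ (timeMeasure T) × Lp (SpaceV Ω) 2 (timeMeasure T),
      IsWeakSolution T β f u₀ p.1 p.2) ∧
    -- the estimates, for the representative `U` of `u` that is continuous with values in `V*`
    ∀ (u : Lp (SpaceH Ω) ⊤ (timeMeasure T)) (μ : Lp (SpaceV Ω) 2 (timeMeasure T)),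
      IsWeakSolution T β f u₀ u μ →
      ∃ (U : ℝ → SpaceH Ω) (u' : Lp (SpaceVdual Ω) 2 (timeMeasure T))
        (b : Lp (SpaceV Ω) 2 (timeMeasure T)),
        (∀ᵐ t ∂timeMeasure T, U t = u t) ∧
        ContinuousOn (fun t => toVdual (U t)) (Icc 0 T) ∧
        U 0 = u₀ ∧
        HasWeakTimeDeriv T (fun t => toVdual (u t)) u' ∧
        (∀ᵐ t ∂timeMeasure T, ∀ᵐ x ∂volume.restrict Ω, toH (b t) x = β (u t x)) ∧
        ∀ t ∈ Icc 0 T,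
          (∫ s in (0 : ℝ)..t, ‖u' s‖ ^ 2) + 2 * c₁ * ‖U t‖ ^ 2 ≤ M₁ ∧
          (∫ s in (0 : ℝ)..t, ‖μ s‖ ^ 2) ≤ M₁ ∧
          (∫ s in (0 : ℝ)..t, ‖b s‖ ^ 2) ≤ 2 * (M₁ + ‖f‖ ^ 2) := by
  obtain ⟨u₁, μ₁, h₁, hest⟩ := exists_isWeakSolution hΩ hT hβ f u₀ hu₀ M₁ hM₁
  refine ⟨⟨(u₁, μ₁), h₁, fun p hp => ?_⟩, fun u μ h => ?_⟩
  · obtain ⟨h2, h3⟩ := hp.unique hΩ hT hβ.maximalMonotone.1 h₁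
    exact Prod.ext h2 h3
  · obtain ⟨rfl, rfl⟩ := h.unique hΩ hT hβ.maximalMonotone.1 h₁
    exact hest
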